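/- Let $k,m\ge 0$ be integers. Let $\mathbb R^{m+1}_1$ be $\mathbb R^{m+1}$ with the Lorentzian product $\langle x,y\rangle_1=x^1y^1+\dots+x^my^m-x^{m+1}y^{m+1}$, let $S^k\subset\mathbb R^{k+1}$ be the unit sphere and $H^m=\{x\in\mathbb R^{m+1}_1:\langle x,x\rangle_1=-1,\ x^{m+1}>0\}$. Let $\bar g$ be the Riemannian product metric of $S^k\times H^m$, that is, the metric induced from $\mathbb R^{k+1}\times\mathbb R^{m+1}_1$, let $\bar D$ be its Levi-Civita connection and let $\bar\psi$ be its product structure, $\bar\psi(X_1+X_2)=X_1-X_2$ for $X_1\in TS^k$, $X_2\in TH^m$. At $(x_1,x_2)\in S^k\times H^m$ put $\xi_1=(x_1,0)$ and $\xi_2=(0,x_2)$, and let $D^0$ be the flat connection of $\mathbb R^{k+1}\times\mathbb R^{m+1}_1$. The curvature of a connection $D$ is $R(X,Y)Z=D_XD_YZ-D_YD_XZ-D_{[X,Y]}Z$. (a) For a tangent vector $X$ and a smooth vector field $Y$ on $S^k\times H^m$, $$D^0_XY=\bar D_XY-\tfrac12\,\bar g(X+\bar\psi X,Y)\,\xi_1+\tfrac12\,\bar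 g(X-\bar\psi X,Y)\,\xi_2 .$$ (b) For smooth vector fields $X,Y,Z$ on $S^k\times H^m$, the curvature $\bar R$ of $\bar D$ is $$\bar R(X,Y)Z=\tfrac12\big(\bar g(\bar\psi Y,Z)X+\bar g(Y,Z)\bar\psi X-\bar g(\bar\psi X,Z)Y-\bar g(X,Z)\bar\psi Y\big).$$ (c) Let $(M^n,g)$ be a smooth Riemannian manifold of dimension $n$ with Levi-Civita connection $D$ and curvature $R$, let $\varphi:M^n\to S^k\times H^m$ be a smooth isometric immersion, of codimension $p$ (so $n+p=k+m$), and let $\nabla$ be the connection induced by $\bar D$ on $\varphi^*T(S^k\times H^m)$. Write $\top$ and $\perp$ for the components tangent and normal to $\varphi$ (tangent components being regarded as vectors of $M^n$). Let $h(X,Y)=(\nabla_X\varphi_*Y)^\perp$ be the second fundamental form, $A_\xi X=-(\nabla_X\xi)^\top$ the Weingarten map, $D^\perp_X\xi=(\nabla_X\xi)^\perp$ the normal connection, $R^\perp$ its curvature, and $(\tilde D_Xh)(Y,Z)=D^\perp_X(h(Y,Z))-h(D_XY,Z)-h(Y,D_XZ)$. Define $f$ and $\bar u$ by $\bar\psi(\varphi_*X)=\varphi_*(fX)+\bar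 u(X)$ with $fX$ tangent to $M^n$ and $\bar u(X)$ normal to $\varphi$. Then, for all smooth vector fields $X,Y,Z$ on $M^n$ and all smooth normal fields $\xi$ of $\varphi$: (Gauss) $\displaystyle R(X,Y)Z=A_{h(Y,Z)}X-A_{h(X,Z)}Y+\tfrac12\big(g(fY,Z)X+g(Y,Z)fX-g(fX,Z)Y-g(X,Z)fY\big)$; (Codazzi) $\displaystyle (\tilde D_Xh)(Y,Z)-(\tilde D_Yh)(X,Z)=\tfrac12\big(g(Y,Z)\bar u(X)-g(X,Z)\bar u(Y)\big)$; (Ricci) $\displaystyle R^\perp(X,Y)\xi=h(A_\xi Y,X)-h(A_\xi X,Y)$. -/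

import Mathlib

open scoped Manifold ContDiff Bundle

noncomputable section

/-! ### Levi-Civita connections, curvature -/

section Connections

variable {E : Type*} [NormedAddCommGroup E] [NormedSpace ℝ E]
  {H : Type*} [TopologicalSpace H] {I : ModelWithCorners ℝ E H}
  {M : Type*} [TopologicalSpace M] [ChartedSpace H M] [IsManifold I 1 M]

/-- A vector field `X` on `M` (a section of the tangent bundle) is smooth. -/
def SmoothField (X : Π x : M, TangentSpace I x) : Prop :=
  ContMDiff I I.tangent ∞ (fun x => (⟨x, X x⟩ : TangentBundle I M))

/-- The connection `D` on `TM` is the Levi-Civita connection of the metric `g`: it has no torsion,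
and `v (g(Y,Z)) = g(D_v Y, Z) + g(Y, D_v Z)`. (In Mathlib `D Y x v` stands for `(D_v Y)(x)`.) -/
def IsLeviCivita [FiniteDimensional ℝ E] [IsManifold I 2 M]
    (g : Π x : M, TangentSpace I x →L[ℝ] TangentSpace I x →L[ℝ] ℝ)
    (D : CovariantDerivative I E (TangentSpace I : M → Type _)) : Prop :=
  D.torsion = 0 ∧
  ∀ (x : M) (v : TangentSpace I x) (Y Z : Π y : M, TangentSpace I y),
    MDifferentiableAt I I.tangent (fun y => (⟨y, Y y⟩ : TangentBundle I M)) x →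
    MDifferentiableAt I I.tangent (fun y => (⟨y, Z y⟩ : TangentBundle I M)) x →
    mvfderiv I (fun y => g y (Y y) (Z y)) x v = g x (D Y x v) (Z x) + g x (Y x) (D Z x v)

/-- The vector field `D_X Y`. -/
def covField (D : CovariantDerivative I E (TangentSpace I : M → Type _))
    (X Y : Π x : M, TangentSpace I x) : Π x : M, TangentSpace I x :=
  fun x => D Y x (X x)

/-- The curvature `R(X,Y)Z = D_X D_Y Z - D_Y D_X Z - D_[X,Y] Z`. -/
def curvature (D : CovariantDerivative I E (TangentSpace I : M → Type _))
    (X Y Z : Π x : M, TangentSpace I x) : Π x : M, TangentSpace I x :=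
  covField D X (covField D Y Z) - covField D Y (covField D X Z)
    - covField D (VectorField.mlieBracket I X Y) Z

end Connections

/-! ### Submanifold geometry: maps `φ : M → N` into a manifold with a metric and a connection -/

section Immersions

variable {E : Type*} [NormedAddCommGroup E] [NormedSpace ℝ E]
  {H : Type*} [TopologicalSpace H] {I : ModelWithCorners ℝ E H}
  {M : Type*} [TopologicalSpace M] [ChartedSpace H M]
  {F : Type*} [NormedAddCommGroup F] [NormedSpace ℝ F]
  {G : Type*} [TopologicalSpace G] {J : ModelWithCorners ℝ F G}
  {N : Type*} [TopologicalSpace N] [ChartedSpace G N]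

/-- A section `s` of the induced bundle `φ^* TN` (a vector field along `φ`) is smooth. -/
def SmoothAlong (I : ModelWithCorners ℝ E H) [IsManifold J 1 N] (φ : M → N) (s : Π x : M, TangentSpace J (φ x)) : Prop :=
  ContMDiff I J.tangent ∞ (fun x => (⟨φ x, s x⟩ : TangentBundle J N))

/-- `φ` is a (smooth) isometric immersion of `(M, g)` into `(N, gN)`. -/
def IsIsometricImmersion
    (g : Π x : M, TangentSpace I x →L[ℝ] TangentSpace I x →L[ℝ] ℝ)
    (gN : Π q : N, TangentSpace J q →L[ℝ] TangentSpace J q →L[ℝ] ℝ) (φ : M → N) : Prop :=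
  ContMDiff I J ∞ φ ∧
  ∀ (x : M) (v w : TangentSpace I x),
    gN (φ x) (mfderiv I J φ x v) (mfderiv I J φ x w) = g x v w

/-- The vector field `φ_* X` along `φ`. -/
def pushField (φ : M → N) (X : Π x : M, TangentSpace I x) : Π x : M, TangentSpace J (φ x) :=
  fun x => mfderiv I J φ x (X x)

/-- The connection induced by `D` on `φ^* TN`, in a local frame: if `E_i` is the frame of `TN` given
by the standard trivialization around `φ x` and `s = ∑ i, c_i • (E_i ∘ φ)` near `x`, then
`∇_v s = ∑ i, v(c_i) • E_i(φ x) + c_i(x) • D_{φ_* v} E_i`. -/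
def covAlong [FiniteDimensional ℝ F] [IsManifold J 1 N] [IsManifold J 2 N]
    (D : CovariantDerivative J F (TangentSpace J : N → Type _)) (φ : M → N)
    (s : Π x : M, TangentSpace J (φ x)) (x : M) :
    TangentSpace I x →L[ℝ] TangentSpace J (φ x) :=
  let e := trivializationAt F (TangentSpace J : N → Type _) (φ x)
  let b := Module.finBasis ℝ F
  let c : Fin (Module.finrank ℝ F) → M → ℝ := fun i y => e.localFrameCoeff J b i (φ y) (s y)
  ∑ i, ((mvfderiv I (c i) x).smulRight (e.localFrame b i (φ x))
    + c i x • (D (e.localFrame b i) (φ x)) ∘L (mfderiv I J φ x))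

/-- On a finite-dimensional tangent space every linear form is `g x v` for exactly one `v`. -/
theorem existsUnique_sharp [FiniteDimensional ℝ E] [IsManifold I 1 M]
    (g : Bundle.ContMDiffRiemannianMetric I ∞ E (TangentSpace I : M → Type _)) (x : M)
    (l : TangentSpace I x →L[ℝ] ℝ) :
    ∃! v : TangentSpace I x, ∀ w, g.inner x v w = l w := by
  have : FiniteDimensional ℝ (TangentSpace I x) := inferInstanceAs (FiniteDimensional ℝ E)
  let T : TangentSpace I x →ₗ[ℝ] Module.Dual ℝ (TangentSpace I x) :=
    { toFun := fun v => (g.inner x v).toLinearMap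
      map_add' := by intro a b; ext; simp
      map_smul' := by intro a b; ext; simp }
  have hinj : Function.Injective T := by
    rw [injective_iff_map_eq_zero]
    intro v hv
    by_contra hne
    have h1 := g.pos x v hne
    have h2 : g.inner x v v = 0 := congrArg (fun f => f v) hv
    exact absurd h2 h1.ne'
  have hsurj : Function.Surjective T :=
    (LinearMap.injective_iff_surjective_of_finrank_eq_finrank
      (Subspace.dual_finrank_eq (K := ℝ) (V := TangentSpace I x)).symm).1 hinj
  obtain ⟨v, hv⟩ := hsurj l.toLinearMap
  refine ⟨v, fun w => congrArg (fun f => f w) hv, fun v' hv' => hinj ?_⟩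
  rw [hv]
  ext w
  exact hv' w

variable [FiniteDimensional ℝ E] [IsManifold I 1 M]

/-- For an isometric immersion `φ` and `w ∈ T_{φ x} N`: the vector `w^⊤ ∈ T_x M` such that
`φ_* w^⊤` is the component of `w` tangent to `φ`, i.e. `g(w^⊤, u) = gN(w, φ_* u)` for all `u`. -/
def tangentPart (g : Bundle.ContMDiffRiemannianMetric I ∞ E (TangentSpace I : M → Type _))
    (gN : Π q : N, TangentSpace J q →L[ℝ] TangentSpace J q →L[ℝ] ℝ) (φ : M → N)
    (x : M) (w : TangentSpace J (φ x)) : TangentSpace I x :=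
  (existsUnique_sharp g x (gN (φ x) w ∘L mfderiv I J φ x)).choose

/-- The component `w^⊥` of `w ∈ T_{φ x} N` normal to `φ`. -/
def normalPart (g : Bundle.ContMDiffRiemannianMetric I ∞ E (TangentSpace I : M → Type _))
    (gN : Π q : N, TangentSpace J q →L[ℝ] TangentSpace J q →L[ℝ] ℝ) (φ : M → N)
    (x : M) (w : TangentSpace J (φ x)) : TangentSpace J (φ x) :=
  w - mfderiv I J φ x (tangentPart g gN φ x w)

/-- A vector field along `φ` is normal: it is a section of the normal bundle of `φ`. -/
def IsNormalField (I : ModelWithCorners ℝ E H)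
    (gN : Π q : N, TangentSpace J q →L[ℝ] TangentSpace J q →L[ℝ] ℝ) (φ : M → N)
    (ξ : Π x : M, TangentSpace J (φ x)) : Prop :=
  ∀ (x : M) (v : TangentSpace I x), gN (φ x) (ξ x) (mfderiv I J φ x v) = 0

variable [FiniteDimensional ℝ F] [IsManifold J 1 N] [IsManifold J 2 N]
  (g : Bundle.ContMDiffRiemannianMetric I ∞ E (TangentSpace I : M → Type _))
  (gN : Π q : N, TangentSpace J q →L[ℝ] TangentSpace J q →L[ℝ] ℝ)
  (DN : CovariantDerivative J F (TangentSpace J : N → Type _)) (φ : M → N)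

/-- The second fundamental form `h(X,Y) = (∇_X φ_* Y)^⊥`. -/
def secondFF (X Y : Π x : M, TangentSpace I x) : Π x : M, TangentSpace J (φ x) :=
  fun x => normalPart g gN φ x (covAlong DN φ (pushField (I := I) φ Y) x (X x))

/-- The Weingarten map `A_ξ X = -(∇_X ξ)^⊤` of the normal field `ξ`. -/
def weingarten (ξ : Π x : M, TangentSpace J (φ x)) (X : Π x : M, TangentSpace I x) :
    Π x : M, TangentSpace I x :=
  fun x => -tangentPart g gN φ x (covAlong DN φ ξ x (X x))

/-- The normal connection `D^⊥_X ξ = (∇_X ξ)^⊥`. -/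
def normalCov (X : Π x : M, TangentSpace I x) (ξ : Π x : M, TangentSpace J (φ x)) :
    Π x : M, TangentSpace J (φ x) :=
  fun x => normalPart g gN φ x (covAlong DN φ ξ x (X x))

/-- The normal curvature `R^⊥(X,Y)ξ = D^⊥_X D^⊥_Y ξ - D^⊥_Y D^⊥_X ξ - D^⊥_[X,Y] ξ`. -/
def normalCurvature (X Y : Π x : M, TangentSpace I x) (ξ : Π x : M, TangentSpace J (φ x)) :
    Π x : M, TangentSpace J (φ x) :=
  normalCov g gN DN φ X (normalCov g gN DN φ Y ξ) - normalCov g gN DN φ Y (normalCov g gN DN φ X ξ)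
    - normalCov g gN DN φ (VectorField.mlieBracket I X Y) ξ

/-- The derivative of the second fundamental form for the connections `D` and `D^⊥`:
`(D̃_X h)(Y,Z) = D^⊥_X (h(Y,Z)) - h(D_X Y, Z) - h(Y, D_X Z)`. -/
def covSecondFF (D : CovariantDerivative I E (TangentSpace I : M → Type _))
    (X Y Z : Π x : M, TangentSpace I x) : Π x : M, TangentSpace J (φ x) :=
  normalCov g gN DN φ X (secondFF g gN DN φ Y Z) - secondFF g gN DN φ (covField D X Y) Z
    - secondFF g gN DN φ Y (covField D X Z)

end Immersions

/-! ### The hyperboloid -/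

/-- The Lorentzian product `x^1 y^1 + ⋯ + x^m y^m - x^{m+1} y^{m+1}` on `ℝ^{m+1}_1`. -/
def lorentz (m : ℕ) :
    EuclideanSpace ℝ (Fin (m + 1)) →L[ℝ] EuclideanSpace ℝ (Fin (m + 1)) →L[ℝ] ℝ :=
  ∑ i : Fin m, (coord i.castSucc).smulRight (coord i.castSucc)
    - (coord (Fin.last m)).smulRight (coord (Fin.last m))
where
  coord (i : Fin (m + 1)) : EuclideanSpace ℝ (Fin (m + 1)) →L[ℝ] ℝ := EuclideanSpace.proj i

theorem lorentz_apply (m : ℕ) (x y : EuclideanSpace ℝ (Fin (m + 1))) :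
    lorentz m x y = ∑ i : Fin m, x i.castSucc * y i.castSucc - x (Fin.last m) * y (Fin.last m) := by
  simp [lorentz, lorentz.coord]

/-- The unit sphere `S^k ⊂ ℝ^{k+1}`, with Mathlib's manifold structure. -/
abbrev USphere (k : ℕ) : Type := Metric.sphere (0 : EuclideanSpace ℝ (Fin (k + 1))) 1

/-- The hyperboloid `H^m = {x ∈ ℝ^{m+1}_1 | ⟨x, x⟩₁ = -1, x^{m+1} > 0}`. -/
abbrev Hyperboloid (m : ℕ) : Type :=
  {x : EuclideanSpace ℝ (Fin (m + 1)) // lorentz m x x = -1 ∧ 0 < x (Fin.last m)}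

/-- `H^m` is the graph of `y ↦ √(1 + |y|²)`: the projection to the first `m` coordinates is a
homeomorphism onto `ℝ^m`. -/
def hyperboloidHomeo (m : ℕ) : Hyperboloid m ≃ₜ EuclideanSpace ℝ (Fin m) where
  toFun x := WithLp.toLp 2 (fun i => x.1 i.castSucc)
  invFun y := ⟨WithLp.toLp 2 (Fin.snoc (α := fun _ => ℝ) (fun i => y i) (√(1 + ∑ i, y i ^ 2))), by
    have h : 0 < 1 + ∑ i, y i ^ 2 := by positivity
    refine ⟨?_, by simpa using h⟩
    rw [lorentz_apply]
    simp only [Fin.snoc_castSucc, Fin.snoc_last, Real.mul_self_sqrt h.le]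
    simp [pow_two]⟩
  left_inv x := by
    obtain ⟨x, h1, h2⟩ := x
    rw [lorentz_apply] at h1
    ext i
    refine Fin.lastCases ?_ (fun j => ?_) i
    · simp only [Fin.snoc_last]
      rw [Real.sqrt_eq_iff_mul_self_eq (by positivity) h2.le]
      simp only [pow_two]
      linarith
    · simp
  right_inv y := by ext i; simp
  continuous_toFun := by fun_prop
  continuous_invFun := by
    refine Continuous.subtype_mk ?_ _
    refine (PiLp.continuous_toLp 2 _).comp (continuous_pi fun i => ?_)
    refine Fin.lastCases ?_ (fun j => ?_) i
    · simp only [Fin.snoc_last]; fun_prop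
    · simp only [Fin.snoc_castSucc]; fun_prop

instance (m : ℕ) : ChartedSpace (EuclideanSpace ℝ (Fin m)) (Hyperboloid m) :=
  (hyperboloidHomeo m).toOpenPartialHomeomorph.singletonChartedSpace rfl

instance (m : ℕ) : IsManifold (𝓡 m) ∞ (Hyperboloid m) :=
  (hyperboloidHomeo m).toOpenPartialHomeomorph.isManifold_singleton rfl

/-! ### The ambient space `S^k × H^m ⊂ ℝ^{k+1} × ℝ^{m+1}_1` -/

/-- The product manifold `S^k × H^m`. -/
abbrev SxH (k m : ℕ) : Type := USphere k × Hyperboloid m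

/-- The model space of `S^k × H^m`. -/
abbrev SxHModel (k m : ℕ) : Type := EuclideanSpace ℝ (Fin k) × EuclideanSpace ℝ (Fin m)

/-- The flat space `ℝ^{k+1} × ℝ^{m+1}_1`. -/
abbrev FlatSpace (k m : ℕ) : Type :=
  EuclideanSpace ℝ (Fin (k + 1)) × EuclideanSpace ℝ (Fin (m + 1))

/-- The Lorentzian metric `⟨(a, b), (a', b')⟩ = ⟨a, a'⟩ + ⟨b, b'⟩₁` of the flat space. -/
def flatMetric (k m : ℕ) : FlatSpace k m →L[ℝ] FlatSpace k m →L[ℝ] ℝ :=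
  (innerSL ℝ).bilinearComp (ContinuousLinearMap.fst ℝ _ _) (ContinuousLinearMap.fst ℝ _ _)
    + (lorentz m).bilinearComp (ContinuousLinearMap.snd ℝ _ _) (ContinuousLinearMap.snd ℝ _ _)

/-- The model with corners of `S^k × H^m`. -/
abbrev sxhI (k m : ℕ) := (𝓡 k).prod (𝓡 m)

variable {k m : ℕ}

/-- The standard embedding `S^k × H^m ⊂ ℝ^{k+1} × ℝ^{m+1}_1`. -/
def sxhIncl (q : SxH k m) : FlatSpace k m := (q.1.1, q.2.1)

/-- The derivative of the embedding, `T_q (S^k × H^m) → ℝ^{k+1} × ℝ^{m+1}_1`. -/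
def sxhEmb (q : SxH k m) : TangentSpace (sxhI k m) q →L[ℝ] FlatSpace k m :=
  mvfderiv (sxhI k m) sxhIncl q

/-- The Riemannian product metric `ḡ` of `S^k × H^m`, induced from `ℝ^{k+1} × ℝ^{m+1}_1`. -/
def sxhMetric (q : SxH k m) :
    TangentSpace (sxhI k m) q →L[ℝ] TangentSpace (sxhI k m) q →L[ℝ] ℝ :=
  ContinuousLinearMap.precomp ℝ (sxhEmb q) ∘L flatMetric k m ∘L sxhEmb q

/-- The product structure `ψ̄(X₁ + X₂) = X₁ - X₂` for `X₁ ∈ T S^k` and `X₂ ∈ T H^m`; in Mathlib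
`T_{(p₁,p₂)} (S^k × H^m)` is `T_{p₁} S^k × T_{p₂} H^m` by definition. -/
def prodStructure (q : SxH k m) :
    TangentSpace (sxhI k m) q →L[ℝ] TangentSpace (sxhI k m) q :=
  (ContinuousLinearMap.id ℝ (TangentSpace (𝓡 k) q.1)).prodMap
    (-ContinuousLinearMap.id ℝ (TangentSpace (𝓡 m) q.2))

/-- The normal vector `ξ₁ = (x₁, 0)` at `(x₁, x₂) ∈ S^k × H^m`. -/
def sxhXi1 (q : SxH k m) : FlatSpace k m := (q.1.1, 0)

/-- The normal vector `ξ₂ = (0, x₂)` at `(x₁, x₂) ∈ S^k × H^m`. -/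
def sxhXi2 (q : SxH k m) : FlatSpace k m := (0, q.2.1)

section ProductStructure

variable {E : Type*} [NormedAddCommGroup E] [NormedSpace ℝ E] [FiniteDimensional ℝ E]
  {H : Type*} [TopologicalSpace H] {I : ModelWithCorners ℝ E H}
  {M : Type*} [TopologicalSpace M] [ChartedSpace H M] [IsManifold I 1 M]
  (g : Bundle.ContMDiffRiemannianMetric I ∞ E (TangentSpace I : M → Type _))
  (φ : M → SxH k m)

/-- `f X`, the tangent part of the product structure: `ψ̄(φ_* X) = φ_*(f X) + ū(X)`. -/
def tangentProd (X : Π x : M, TangentSpace I x) : Π x : M, TangentSpace I x :=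
  fun x => tangentPart g sxhMetric φ x (prodStructure (φ x) (mfderiv I (sxhI k m) φ x (X x)))

/-- `ū(X)`, the normal part of the product structure: `ψ̄(φ_* X) = φ_*(f X) + ū(X)`. -/
def normalProd (X : Π x : M, TangentSpace I x) : Π x : M, TangentSpace (sxhI k m) (φ x) :=
  fun x => normalPart g sxhMetric φ x (prodStructure (φ x) (mfderiv I (sxhI k m) φ x (X x)))

end ProductStructure

end

/-!
Let `ι` be the inclusion of `N = S^k × H^m` into the flat space `V = ℝ^{k+1} × ℝ^{m+1}_1`. All the
equations come from differentiating vector-valued functions in `V`.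

The Levi-Civita connection of a metric induced from `V` is the tangent part of the flat derivative
(`IsLeviCivita.inner_mvfderiv`, the Koszul argument). The normal part of the flat derivative of a
vector field on `N` is found by differentiating `⟨Y, ξ₁⟩ = ⟨Y, ξ₂⟩ = 0`; since `ξ₁`, `ξ₂` and the
tangent space span `V`, this gives the Gauss formula `mvfderiv_sxhEmb` with the second fundamental
form `ambientII`.

Such a Gauss formula, abstracted as `IsFlatGauss`, extends to vector fields along a map `φ : M → N`
and the induced connection `∇` on `φ^* TN` (`IsFlatGauss.mvfderiv_along`). As second derivatives in
`V` commute up to the Lie bracket, the curvature of `∇` is given by the inner products of the second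
fundamental form alone (`IsFlatGauss.inner_curvatureAlong`). For `φ = id` this is the curvature of
`N`; in general it yields
`R^∇(X,Y)s = ½ (ḡ(ψ̄φ_*Y,s) φ_*X + ḡ(φ_*Y,s) ψ̄φ_*X - ḡ(ψ̄φ_*X,s) φ_*Y - ḡ(φ_*X,s) ψ̄φ_*Y)`
(`curvatureAlong_sxh`).

For an isometric immersion `φ` the Gauss and Weingarten formulas express `R^∇(X,Y)φ_*Z` and the
normal part of `R^∇(X,Y)ξ` by the curvatures, second fundamental form and Weingarten maps of `φ`
(`IsFlatGauss.curvatureAlong_pushField`, `IsFlatGauss.normalPart_curvatureAlong`). Comparing tangent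
and normal parts gives the Gauss, Codazzi and Ricci equations. The smoothness of the fields that are
differentiated twice follows from `contMDiffAt_along_of_inner`: a field along `φ` is determined
smoothly by its inner products with tangent vectors.
-/

/-! ### Vector-valued functions on manifolds -/

section VectorValued

open VectorField Topology

variable {E : Type*} [NormedAddCommGroup E] [NormedSpace ℝ E]
  {H : Type*} [TopologicalSpace H] {I : ModelWithCorners ℝ E H}
  {M : Type*} [TopologicalSpace M] [ChartedSpace H M]
  {F : Type*} [NormedAddCommGroup F] [NormedSpace ℝ F]
  {G : Type*} [TopologicalSpace G] {J : ModelWithCorners ℝ F G}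
  {N : Type*} [TopologicalSpace N] [ChartedSpace G N]
  {V : Type*} [NormedAddCommGroup V] [NormedSpace ℝ V]
  {W : Type*} [NormedAddCommGroup W] [NormedSpace ℝ W]
  {V' : Type*} [NormedAddCommGroup V'] [NormedSpace ℝ V']

theorem MDifferentiableAt.hasMFDerivAt_mvfderiv {f : M → V} {x : M}
    (hf : MDifferentiableAt I 𝓘(ℝ, V) f x) :
    HasMFDerivAt I 𝓘(ℝ, V) f x (mvfderiv I f x : TangentSpace I x →L[ℝ] V) :=
  hf.hasMFDerivAt

theorem HasMFDerivAt.mvfderiv_eq {f : M → V} {x : M} {f' : TangentSpace I x →L[ℝ] V}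
    (hf : HasMFDerivAt I 𝓘(ℝ, V) f x f') : mvfderiv I f x = f' :=
  hf.mfderiv

theorem mvfderiv_clm_comp (L : V →L[ℝ] W) {f : M → V} {x : M}
    (hf : MDifferentiableAt I 𝓘(ℝ, V) f x) (v : TangentSpace I x) :
    mvfderiv I (fun y => L (f y)) x v = L (mvfderiv I f x v) := by
  have h := HasMFDerivAt.comp x (L.hasMFDerivAt (x := f x)) hf.hasMFDerivAt_mvfderiv
  exact congrArg (fun l => l v) (HasMFDerivAt.mvfderiv_eq h)

theorem mvfderiv_bilin (B : V →L[ℝ] W →L[ℝ] V') {f : M → V} {g : M → W} {x : M}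
    (hf : MDifferentiableAt I 𝓘(ℝ, V) f x) (hg : MDifferentiableAt I 𝓘(ℝ, W) g x)
    (v : TangentSpace I x) :
    mvfderiv I (fun y => B (f y) (g y)) x v =
      B (mvfderiv I f x v) (g x) + B (f x) (mvfderiv I g x v) := by
  have h1 : HasFDerivAt (fun p : V × W => B p.1 p.2)
      (B.deriv₂ (f x, g x)) (f x, g x) := B.isBoundedBilinearMap.hasFDerivAt _
  have h2 : HasMFDerivAt I 𝓘(ℝ, V × W) (fun y => (f y, g y)) x
      ((mvfderiv I f x).prod (mvfderiv I g x)) :=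
    ⟨hf.continuousAt.prodMk hg.continuousAt,
      hf.hasMFDerivAt_mvfderiv.2.prodMk hg.hasMFDerivAt_mvfderiv.2⟩
  have h := HasMFDerivAt.comp x h1.hasMFDerivAt h2
  refine (congrArg (fun l => l v) (HasMFDerivAt.mvfderiv_eq h)).trans ?_
  exact add_comm _ _

theorem mvfderiv_congr {f f' : M → V} {x : M} (h : f =ᶠ[𝓝 x] f') :
    mvfderiv I f x = mvfderiv I f' x := by
  have := h.mfderiv_eq (I := I) (I' := 𝓘(ℝ, V))
  ext v
  exact congrArg (fun l => l v) this

theorem mvfderiv_fun_sum {ι : Type*} (t : Finset ι) {f : ι → M → V} {x : M}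
    (hf : ∀ i ∈ t, MDifferentiableAt I 𝓘(ℝ, V) (f i) x) (v : TangentSpace I x) :
    mvfderiv I (fun y => ∑ i ∈ t, f i y) x v = ∑ i ∈ t, mvfderiv I (f i) x v := by
  have h : HasMFDerivAt I 𝓘(ℝ, V) (fun y => ∑ i ∈ t, f i y) x
      (∑ i ∈ t, mvfderiv I (f i) x : TangentSpace I x →L[ℝ] V) :=
    ⟨tendsto_finsetSum _ fun i hi => (hf i hi).continuousAt,
      HasFDerivWithinAt.fun_sum fun i hi => (hf i hi).hasMFDerivAt_mvfderiv.2⟩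
  rw [HasMFDerivAt.mvfderiv_eq h]
  simp

theorem mvfderiv_comp_mfderiv {f : N → V} {φ : M → N} {x : M}
    (hf : MDifferentiableAt J 𝓘(ℝ, V) f (φ x)) (hφ : MDifferentiableAt I J φ x)
    (v : TangentSpace I x) :
    mvfderiv I (fun y => f (φ y)) x v = mvfderiv J f (φ x) (mfderiv I J φ x v) := by
  have h := HasMFDerivAt.comp x hf.hasMFDerivAt_mvfderiv hφ.hasMFDerivAt
  exact congrArg (fun l => l v) (HasMFDerivAt.mvfderiv_eq h)

variable [IsManifold J 1 N]

/-- If `s` is smooth along `φ`, then so is the vector-valued function `dι(s)`. -/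
theorem ContMDiffAt.mvfderiv_along {ι : N → V} (hι : ContMDiff J 𝓘(ℝ, V) ∞ ι) {φ : M → N}
    {s : Π x : M, TangentSpace J (φ x)} {x : M}
    (hs : ContMDiffAt I J.tangent ∞ (fun y => (⟨φ y, s y⟩ : TangentBundle J N)) x) :
    ContMDiffAt I 𝓘(ℝ, V) ∞ (fun y => mvfderiv J ι (φ y) (s y)) x :=
  ((contMDiff_snd_tangentBundle_modelSpace V 𝓘(ℝ, V)).contMDiffAt.comp _
    (hι.contMDiff_tangentMap (m := ∞) le_rfl).contMDiffAt).comp x hs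

theorem MDifferentiableAt.mvfderiv_along {ι : N → V} (hι : ContMDiff J 𝓘(ℝ, V) ∞ ι) {φ : M → N}
    {s : Π x : M, TangentSpace J (φ x)} {x : M}
    (hs : MDifferentiableAt I J.tangent (fun y => (⟨φ y, s y⟩ : TangentBundle J N)) x) :
    MDifferentiableAt I 𝓘(ℝ, V) (fun y => mvfderiv J ι (φ y) (s y)) x :=
  (((contMDiff_snd_tangentBundle_modelSpace V 𝓘(ℝ, V)).contMDiffAt.comp _
    (hι.contMDiff_tangentMap (m := ∞) le_rfl).contMDiffAt).mdifferentiableAt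
      (by simp)).comp x hs

/-- The Lie bracket acts on vector-valued functions as the commutator of derivations. -/
theorem VectorField.mvfderiv_mlieBracket [I.Boundaryless] [FiniteDimensional ℝ E]
    [IsManifold I ∞ M] [IsManifold I 1 M] {f : M → V} (hf : ContMDiff I 𝓘(ℝ, V) ∞ f)
    {X Y : Π x : M, TangentSpace I x} {x : M}
    (hX : MDifferentiableAt I I.tangent (fun y => (⟨y, X y⟩ : TangentBundle I M)) x)
    (hY : MDifferentiableAt I I.tangent (fun y => (⟨y, Y y⟩ : TangentBundle I M)) x) :
    mvfderiv I f x (mlieBracket I X Y x) =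
      mvfderiv I (fun y => mvfderiv I f y (Y y)) x (X x)
        - mvfderiv I (fun y => mvfderiv I f y (X y)) x (Y x) := by
  have h2 : (2 : ℕ∞ω) ≤ ∞ := by norm_cast
  have : IsManifold I 2 M := IsManifold.of_le (n := ∞) h2
  have : CompleteSpace E := FiniteDimensional.complete ℝ E
  set ψ := extChartAt I x with hψ
  set c : E → V := f ∘ ψ.symm with hc
  have hcd : ∀ z ∈ ψ.target, ContDiffAt ℝ ∞ c z := by
    intro z hz
    have h1 : ContMDiffAt 𝓘(ℝ, E) I ∞ ψ.symm z := by
      have := contMDiffWithinAt_extChartAt_symm_range (I := I) (n := ∞) x hz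
      rwa [I.range_eq_univ, contMDiffWithinAt_univ] at this
    exact (hf.contMDiffAt.comp z h1).contDiffAt
  -- the derivative of `f` in the chart
  have hA : ∀ y ∈ ψ.source, ∀ (c' : E → V), DifferentiableAt ℝ c' (ψ y) →
      ∀ v : TangentSpace I y, mvfderiv I (c' ∘ ψ) y v =
        fderiv ℝ c' (ψ y) (mfderiv I 𝓘(ℝ, E) ψ y v) := by
    intro y hy c' hc' v
    have h1 : HasMFDerivAt I 𝓘(ℝ, E) ψ y (mfderiv I 𝓘(ℝ, E) ψ y) :=
      (mdifferentiableAt_extChartAt (by simpa [hψ] using hy)).hasMFDerivAt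
    have h := HasMFDerivAt.comp y hc'.hasFDerivAt.hasMFDerivAt h1
    exact congrArg (fun l => l v) (HasMFDerivAt.mvfderiv_eq h)
  have hfc : ∀ y ∈ ψ.source, f =ᶠ[𝓝 y] c ∘ ψ := by
    intro y hy
    filter_upwards [(isOpen_extChartAt_source x).mem_nhds hy] with z hz
    simp [hc, ψ.left_inv hz]
  have hf' : ∀ y ∈ ψ.source, ∀ v : TangentSpace I y,
      mvfderiv I f y v = fderiv ℝ c (ψ y) (mfderiv I 𝓘(ℝ, E) ψ y v) := by
    intro y hy v
    rw [mvfderiv_congr (hfc y hy)]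
    exact hA y hy c ((hcd _ (ψ.map_source hy)).differentiableAt (by simp)) v
  -- the representation of a vector field in the chart
  let P : (Π x : M, TangentSpace I x) → E → E :=
    fun Z => mpullbackWithin 𝓘(ℝ, E) I ψ.symm Z (Set.range I)
  have hpush : ∀ (Z : Π x : M, TangentSpace I x), ∀ᶠ y in 𝓝 x,
      (mfderiv I 𝓘(ℝ, E) ψ y (Z y) : E) = P Z (ψ y) := by
    intro Z
    have h := eventuallyEq_mpullback_mpullbackWithin_extChartAt (I := I) (s := Set.univ) (x := x) Z
    rw [nhdsWithin_univ] at h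
    filter_upwards [h, (isOpen_extChartAt_source x).mem_nhds (mem_extChartAt_source (I := I) x)]
      with y hy hys
    rw [hy, mpullback_apply]
    exact (isInvertible_mfderiv_extChartAt hys).self_apply_inverse _
  have hdiff : ∀ (Z : Π x : M, TangentSpace I x),
      MDifferentiableAt I I.tangent (fun y => (⟨y, Z y⟩ : TangentBundle I M)) x →
      DifferentiableAt ℝ (P Z) (ψ x) := by
    intro Z hZ
    have h : DifferentiableWithinAt ℝ (P Z) (ψ.symm ⁻¹' Set.univ ∩ Set.range I) (ψ x) :=
      MDifferentiableWithinAt.differentiableWithinAt_mpullbackWithin_vectorField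
        (mdifferentiableWithinAt_univ.2 hZ)
    rwa [I.range_eq_univ, Set.preimage_univ, Set.inter_univ, differentiableWithinAt_univ] at h
  have hx : x ∈ ψ.source := mem_extChartAt_source x
  have hsec : ∀ (Z U : Π x : M, TangentSpace I x),
      MDifferentiableAt I I.tangent (fun y => (⟨y, Z y⟩ : TangentBundle I M)) x →
      mvfderiv I (fun y => mvfderiv I f y (Z y)) x (U x) =
        fderiv ℝ (fun z => fderiv ℝ c z (P Z z))
          (ψ x) (P U (ψ x)) := by
    intro Z U hZ
    have h1 : (fun y => mvfderiv I f y (Z y)) =ᶠ[𝓝 x]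
        (fun z => fderiv ℝ c z (P Z z)) ∘ ψ := by
      filter_upwards [(isOpen_extChartAt_source x).mem_nhds hx, hpush Z] with y hy hZy
      rw [hf' y hy, hZy]
      rfl
    rw [mvfderiv_congr h1, hA x hx, (hpush U).self_of_nhds]
    exact (((hcd _ (ψ.map_source hx)).fderiv_right (m := 1)
      (by norm_cast)).differentiableAt (by simp)).clm_apply (hdiff Z hZ)
  rw [hsec Y X hY, hsec X Y hX, hf' x hx]
  -- in the chart the claim is the symmetry of the second derivative of `c`
  have hsymm : IsSymmSndFDerivAt ℝ c (ψ x) :=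
    (hcd _ (ψ.map_source hx)).isSymmSndFDerivAt (by simpa using h2)
  rw [← fderiv_apply_lieBracket_of_isSymmSndFDerivAt
    ((hcd _ (ψ.map_source hx)).of_le h2) hsymm (hdiff Y hY) (hdiff X hX)]
  let L : E := lieBracket ℝ (P X) (P Y) (ψ x)
  have hb : mlieBracket I X Y x = (mfderiv I 𝓘(ℝ, E) ψ x).inverse L := by
    have h : lieBracketWithin ℝ (P X) (P Y) (ψ.symm ⁻¹' Set.univ ∩ Set.range I) (ψ x) = L := by
      rw [I.range_eq_univ, Set.preimage_univ, Set.inter_univ, lieBracketWithin_univ]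
    rw [← h]
    rfl
  rw [hb]
  exact congrArg _ ((isInvertible_mfderiv_extChartAt hx).self_apply_inverse _)

/-- A family of linear maps on a finite-dimensional space is smooth if it is so pointwise. -/
theorem contMDiffAt_clm_of_apply [FiniteDimensional ℝ F] {n : ℕ∞ω} {A : M → F →L[ℝ] V} {x : M}
    (h : ∀ b, ContMDiffAt I 𝓘(ℝ, V) n (fun y => A y b) x) :
    ContMDiffAt I 𝓘(ℝ, F →L[ℝ] V) n A x := by
  let b := Module.finBasis ℝ F
  have hA : A = fun y => ∑ i, ContinuousLinearMap.smulRightL ℝ F V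
      (LinearMap.toContinuousLinearMap (b.coord i)) (A y (b i)) := by
    funext y
    ext v
    conv_lhs => rw [← b.sum_repr v]
    simp only [map_sum, map_smul]
    simp
  rw [hA]
  refine contMDiffAt_finsetSum fun i _ => ?_
  exact (ContinuousLinearMap.contMDiff _).contMDiffAt.comp x (h (b i))

/-- A vector field `s` along `φ` is smooth if `dι(s)` has the same inner products with the vectors
`dι(u)` as a smooth `V`-valued function `w`. In a trivialization `s` is the solution of a linear
system whose matrix is the Gram form of `dι`, invertible by `hnd`. -/
theorem contMDiffAt_along_of_inner [FiniteDimensional ℝ F] [IsManifold J ∞ N]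
    (B : V →L[ℝ] V →L[ℝ] ℝ)
    {ι : N → V} (hι : ContMDiff J 𝓘(ℝ, V) ∞ ι)
    (hnd : ∀ (q : N) (v : TangentSpace J q),
      (∀ u : TangentSpace J q, B (mvfderiv J ι q v) (mvfderiv J ι q u) = 0) → v = 0)
    {φ : M → N} {x₀ : M} (hφ : ContMDiffAt I J ∞ φ x₀) {s : Π x : M, TangentSpace J (φ x)}
    {w : M → V} (hw : ContMDiffAt I 𝓘(ℝ, V) ∞ w x₀)
    (hs : ∀ (x : M) (u : TangentSpace J (φ x)),
      B (mvfderiv J ι (φ x) (s x)) (mvfderiv J ι (φ x) u) = B (w x) (mvfderiv J ι (φ x) u)) :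
    ContMDiffAt I J.tangent ∞ (fun y => (⟨φ y, s y⟩ : TangentBundle J N)) x₀ := by
  have : CompleteSpace F := FiniteDimensional.complete ℝ F
  set e := trivializationAt F (TangentSpace J : N → Type _) (φ x₀) with he
  have hbase : ∀ᶠ x in 𝓝 x₀, φ x ∈ e.baseSet :=
    hφ.continuousAt.eventually_mem (e.open_baseSet.mem_nhds
      (FiberBundle.mem_baseSet_trivializationAt' (φ x₀)))
  have hbase₀ : φ x₀ ∈ e.baseSet := hbase.self_of_nhds
  -- the derivative of `ι` in the trivialization
  let A : M → F →L[ℝ] V := fun x => mvfderiv J ι (φ x) ∘L e.symmL ℝ (φ x)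
  have hAb : ∀ b, ContMDiffAt I 𝓘(ℝ, V) ∞ (fun x => A x b) x₀ := by
    intro b
    refine ContMDiffAt.mvfderiv_along hι (s := fun x => e.symmL ℝ (φ x) b) ?_
    have h1 : ContMDiffAt J J.tangent ∞
        (fun q => (⟨q, e.symmL ℝ q b⟩ : TangentBundle J N)) (φ x₀) := by
      rw [e.contMDiffAt_section_iff hbase₀]
      refine (contMDiffAt_const (c := b)).congr_of_eventuallyEq ?_
      filter_upwards [e.open_baseSet.mem_nhds hbase₀] with q hq
      simp [hq]
    exact h1.comp x₀ hφ
  have hA : ContMDiffAt I 𝓘(ℝ, F →L[ℝ] V) ∞ A x₀ := contMDiffAt_clm_of_apply hAb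
  -- the Gram form
  let T : M → F →L[ℝ] F →L[ℝ] ℝ := fun x => B.bilinearComp (A x) (A x)
  have hT : ContMDiffAt I 𝓘(ℝ, F →L[ℝ] F →L[ℝ] ℝ) ∞ T x₀ := by
    refine contMDiffAt_clm_of_apply fun a => contMDiffAt_clm_of_apply fun b => ?_
    exact ((B.contMDiff.contMDiffAt.comp x₀ (hAb a)).clm_apply (hAb b))
  let r : M → F →L[ℝ] ℝ := fun x => B (w x) ∘L A x
  have hr : ContMDiffAt I 𝓘(ℝ, F →L[ℝ] ℝ) ∞ r x₀ :=
    (B.contMDiff.contMDiffAt.comp x₀ hw).clm_comp hA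
  have hTinv : ∀ x, φ x ∈ e.baseSet → (T x).IsInvertible := by
    intro x hx
    have hinj : Function.Injective (T x) := by
      rw [injective_iff_map_eq_zero]
      intro v hv
      have h1 : e.symmL ℝ (φ x) v = 0 := by
        refine hnd (φ x) _ fun u => ?_
        have h2 := congrArg (fun l => l (e.continuousLinearMapAt ℝ (φ x) u)) hv
        simp only [T, A, ContinuousLinearMap.bilinearComp_apply, ContinuousLinearMap.comp_apply,
          e.symmL_continuousLinearMapAt hx] at h2
        exact h2
      have h3 := congrArg (e.continuousLinearMapAt ℝ (φ x)) h1
      rwa [e.continuousLinearMapAt_symmL hx, map_zero] at h3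
    have hdim : Module.finrank ℝ F = Module.finrank ℝ (F →L[ℝ] ℝ) := by
      rw [← LinearMap.toContinuousLinearMap.finrank_eq]
      exact Subspace.dual_finrank_eq.symm
    exact ⟨(LinearEquiv.ofBijective (T x).toLinearMap ⟨hinj,
      (LinearMap.injective_iff_surjective_of_finrank_eq_finrank hdim).1
        hinj⟩).toContinuousLinearEquiv, rfl⟩
  have hσ : ∀ x, φ x ∈ e.baseSet →
      (e (⟨φ x, s x⟩ : TangentBundle J N)).2 = (T x).inverse (r x) := by
    intro x hx
    symm
    rw [(hTinv x hx).inverse_apply_eq]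
    ext b
    have h1 := hs x (e.symmL ℝ (φ x) b)
    have h2 : e.symmL ℝ (φ x) (e (⟨φ x, s x⟩ : TangentBundle J N)).2 = s x := by
      have := e.symmL_continuousLinearMapAt hx (R := ℝ) (s x)
      rwa [e.continuousLinearMapAt_apply (R := ℝ), e.linearMapAt_apply, if_pos hx] at this
    simp only [T, r, A, ContinuousLinearMap.bilinearComp_apply, ContinuousLinearMap.comp_apply, h2]
    exact h1.symm
  rw [e.contMDiffAt_iff (by simpa [e.mem_source] using hbase₀)]
  refine ⟨hφ, ?_⟩
  have h1 : ContMDiffAt I 𝓘(ℝ, F) ∞ (fun x => (T x).inverse (r x)) x₀ :=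
    (((hTinv x₀ hbase₀).contDiffAt_map_inverse (n := ∞)).contMDiffAt.comp x₀ hT).clm_apply hr
  refine h1.congr_of_eventuallyEq ?_
  filter_upwards [hbase] with x hx
  exact hσ x hx

/-- If `g` is induced by `ι`, then `g(D_v Y, w)` is the inner product of the derivative of `dι(Y)`
along `v` with `dι(w)`. The difference `A(X, Y, Z)` of the two sides is symmetric in `X, Y` (no
torsion) and skew in `Y, Z` (both sides obey the product rule), hence zero. -/
theorem IsLeviCivita.inner_mvfderiv [FiniteDimensional ℝ E] [I.Boundaryless] [IsManifold I ∞ M]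
    [IsManifold I 1 M] [IsManifold I 2 M]
    {B : V →L[ℝ] V →L[ℝ] ℝ} (hB : ∀ a b, B a b = B b a)
    {ι : M → V} (hι : ContMDiff I 𝓘(ℝ, V) ∞ ι)
    {g : Π x : M, TangentSpace I x →L[ℝ] TangentSpace I x →L[ℝ] ℝ}
    (hg : ∀ (x : M) (v w : TangentSpace I x), g x v w = B (mvfderiv I ι x v) (mvfderiv I ι x w))
    {D : CovariantDerivative I E (TangentSpace I : M → Type _)} (hD : IsLeviCivita g D)
    {Y : Π x : M, TangentSpace I x} {x : M}
    (hY : MDifferentiableAt I I.tangent (fun y => (⟨y, Y y⟩ : TangentBundle I M)) x)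
    (v w : TangentSpace I x) :
    B (mvfderiv I (fun y => mvfderiv I ι y (Y y)) x v) (mvfderiv I ι x w) = g x (D Y x v) w := by
  let A : (X Y Z : Π x : M, TangentSpace I x) → ℝ := fun X Y Z =>
    B (mvfderiv I (fun y => mvfderiv I ι y (Y y)) x (X x)) (mvfderiv I ι x (Z x))
      - g x (D Y x (X x)) (Z x)
  have hsymm : ∀ X Y Z : Π x : M, TangentSpace I x,
      MDifferentiableAt I I.tangent (fun y => (⟨y, X y⟩ : TangentBundle I M)) x →
      MDifferentiableAt I I.tangent (fun y => (⟨y, Y y⟩ : TangentBundle I M)) x →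
      A X Y Z = A Y X Z := by
    intro X Y Z hX hY
    have h1 := VectorField.mvfderiv_mlieBracket hι hX hY
    have h2 := D.torsion_eq_zero_iff.1 hD.1 hX hY
    have h3 : g x (D Y x (X x)) (Z x) - g x (D X x (Y x)) (Z x) =
        B (mvfderiv I ι x (mlieBracket I X Y x)) (mvfderiv I ι x (Z x)) := by
      rw [← hg, ← h2]
      simp
    rw [h1, map_sub, sub_apply] at h3
    simp only [A]
    linarith
  have hskew : ∀ X Y Z : Π x : M, TangentSpace I x,
      MDifferentiableAt I I.tangent (fun y => (⟨y, Y y⟩ : TangentBundle I M)) x →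
      MDifferentiableAt I I.tangent (fun y => (⟨y, Z y⟩ : TangentBundle I M)) x →
      A X Y Z = - A X Z Y := by
    intro X Y Z hY hZ
    have h1 := hD.2 x (X x) Y Z hY hZ
    simp only [hg] at h1
    have h2 := mvfderiv_bilin B (hY.mvfderiv_along (φ := id) hι) (hZ.mvfderiv_along (φ := id) hι)
      (X x)
    simp only [id] at h2
    rw [h2, hB (mvfderiv I ι x (Y x)), hB (mvfderiv I ι x (Y x))] at h1
    simp only [A, hg]
    linarith
  let X := FiberBundle.extend E v
  let Z := FiberBundle.extend E w
  have hX : MDifferentiableAt I I.tangent (fun y => (⟨y, X y⟩ : TangentBundle I M)) x :=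
    FiberBundle.mdifferentiableAt_extend ..
  have hZ : MDifferentiableAt I I.tangent (fun y => (⟨y, Z y⟩ : TangentBundle I M)) x :=
    FiberBundle.mdifferentiableAt_extend ..
  have key : A X Y Z = 0 := by
    have := hsymm X Y Z hX hY
    have := hskew Y X Z hX hZ
    have := hsymm Y Z X hY hZ
    have := hskew Z Y X hY hX
    have := hsymm Z X Y hZ hX
    have := hskew X Z Y hZ hY
    linarith
  have hXx : X x = v := FiberBundle.extend_apply_self ..
  have hZx : Z x = w := FiberBundle.extend_apply_self ..
  simp only [A, hXx, hZx] at key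
  linarith

/-- A Gauss formula with second fundamental form `α` passes from vector fields on `N` to vector
fields along `φ` and the induced connection. -/
theorem mvfderiv_along_of_covariantDerivative [FiniteDimensional ℝ F] [IsManifold J ∞ N]
    [IsManifold J 2 N] {ι : N → V} (hι : ContMDiff J 𝓘(ℝ, V) ∞ ι)
    {D : CovariantDerivative J F (TangentSpace J : N → Type _)}
    {α : Π q : N, TangentSpace J q → TangentSpace J q →L[ℝ] V}
    (hD : ∀ (Y : Π q : N, TangentSpace J q) (q : N),
      MDifferentiableAt J J.tangent (fun q' => (⟨q', Y q'⟩ : TangentBundle J N)) q →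
      ∀ v : TangentSpace J q, mvfderiv J (fun q' => mvfderiv J ι q' (Y q')) q v =
        mvfderiv J ι q (D Y q v) + α q v (Y q))
    {φ : M → N} {x : M} {s : Π x : M, TangentSpace J (φ x)}
    (hs : ContMDiffAt I J.tangent ∞ (fun y => (⟨φ y, s y⟩ : TangentBundle J N)) x)
    (v : TangentSpace I x) :
    mvfderiv I (fun y => mvfderiv J ι (φ y) (s y)) x v =
      mvfderiv J ι (φ x) (covAlong D φ s x v) + α (φ x) (mfderiv I J φ x v) (s x) := by
  have : CompleteSpace F := FiniteDimensional.complete ℝ F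
  set e := trivializationAt F (TangentSpace J : N → Type _) (φ x) with he
  set b := Module.finBasis ℝ F with hb
  set c : Fin (Module.finrank ℝ F) → M → ℝ :=
    fun i y => e.localFrameCoeff J b i (φ y) (s y) with hc
  have hφ : ContMDiffAt I J ∞ φ x := (Bundle.contMDiffAt_totalSpace.1 hs).1
  have hbase₀ : φ x ∈ e.baseSet := FiberBundle.mem_baseSet_trivializationAt' (φ x)
  have hbase : ∀ᶠ y in 𝓝 x, φ y ∈ e.baseSet :=
    hφ.continuousAt.eventually_mem (e.open_baseSet.mem_nhds hbase₀)
  have hcoeff : ∀ i, ∀ y, φ y ∈ e.baseSet →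
      c i y = b.repr (e (⟨φ y, s y⟩ : TangentBundle J N)).2 i := by
    intro i y hy
    have := e.localFrameCoeff_eq_coeff (I := J) (b := b) (i := i) hy
      (s := FiberBundle.extend F (s y))
    simpa using this
  have hcd : ∀ i, MDifferentiableAt I 𝓘(ℝ) (c i) x := by
    intro i
    have h1 : ContMDiffAt I 𝓘(ℝ, F) ∞ (fun y => (e (⟨φ y, s y⟩ : TangentBundle J N)).2) x :=
      (Bundle.contMDiffAt_totalSpace.1 hs).2
    have h2 : ContMDiffAt I 𝓘(ℝ) ∞ (fun y => LinearMap.toContinuousLinearMap (b.coord i)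
        (e (⟨φ y, s y⟩ : TangentBundle J N)).2) x :=
      (ContinuousLinearMap.contMDiff _).contMDiffAt.comp x h1
    refine (h2.mdifferentiableAt (by simp)).congr_of_eventuallyEq ?_
    filter_upwards [hbase] with y hy
    simp [hcoeff i y hy]
  have hfr : ∀ i, MDifferentiableAt J J.tangent
      (fun q => (⟨q, e.localFrame b i q⟩ : TangentBundle J N)) (φ x) := fun i =>
    (contMDiffAt_localFrame_of_mem 1 e b i hbase₀).mdifferentiableAt one_ne_zero
  have hsum : ∀ y, φ y ∈ e.baseSet → s y = ∑ i, c i y • e.localFrame b i (φ y) := by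
    intro y hy
    have := e.eq_sum_localFrameCoeff_smul (I := J) (b := b) hy
      (s := FiberBundle.extend F (s y))
    simpa using this
  have hframe : ∀ i, MDifferentiableAt I 𝓘(ℝ, V)
      (fun y => mvfderiv J ι (φ y) (e.localFrame b i (φ y))) x := fun i =>
    MDifferentiableAt.comp x ((hfr i).mvfderiv_along (φ := id) hι)
      (hφ.mdifferentiableAt (by simp))
  -- expand `s` in the frame that defines `covAlong`, and apply `hD` to the frame fields
  have hev : (fun y => mvfderiv J ι (φ y) (s y)) =ᶠ[𝓝 x]
      fun y => ∑ i, c i y • mvfderiv J ι (φ y) (e.localFrame b i (φ y)) := by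
    filter_upwards [hbase] with y hy
    conv_lhs => rw [hsum y hy]
    simp only [map_sum, map_smul]
  have hprod : ∀ i, MDifferentiableAt I 𝓘(ℝ, V)
      (fun y => c i y • mvfderiv J ι (φ y) (e.localFrame b i (φ y))) x := fun i =>
    (hcd i).smul (hframe i)
  rw [mvfderiv_congr hev, mvfderiv_fun_sum _ fun i _ => hprod i]
  have hterm : ∀ i, mvfderiv I
      (fun y => c i y • mvfderiv J ι (φ y) (e.localFrame b i (φ y))) x v =
      mvfderiv J ι (φ x) ((mvfderiv I (c i) x v) • e.localFrame b i (φ x)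
        + c i x • D (e.localFrame b i) (φ x) (mfderiv I J φ x v))
      + c i x • α (φ x) (mfderiv I J φ x v) (e.localFrame b i (φ x)) := by
    intro i
    rw [mvfderiv_fun_smul (hcd i) (hframe i)]
    have h1 := mvfderiv_comp_mfderiv ((hfr i).mvfderiv_along (φ := id) hι)
      (hφ.mdifferentiableAt (by simp)) v
    have h2 : mvfderiv I (fun y => mvfderiv J ι (φ y) (e.localFrame b i (φ y))) x v = _ :=
      h1.trans (hD _ _ (hfr i) _)
    simp only [add_apply, smul_apply, ContinuousLinearMap.smulRight_apply, map_add, map_smul]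
    rw [h2]
    module
  have hαs : α (φ x) (mfderiv I J φ x v) (s x) = ∑ i, c i x •
      α (φ x) (mfderiv I J φ x v) (e.localFrame b i (φ x)) := by
    conv_lhs => rw [hsum x hbase₀]
    simp only [map_sum, map_smul]
  rw [Finset.sum_congr rfl fun i _ => hterm i, Finset.sum_add_distrib, ← hαs, ← map_sum]
  congr 2
  simp only [covAlong]
  rw [sum_apply]
  rfl

end VectorValued

noncomputable section

/-! ### The product `S^k × H^m` in the flat space -/

section Ambient

variable {k m : ℕ}

theorem lorentz_comm (x y : EuclideanSpace ℝ (Fin (m + 1))) : lorentz m x y = lorentz m y x := by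
  simp only [lorentz_apply, mul_comm]

theorem flatMetric_apply (a b : FlatSpace k m) :
    flatMetric k m a b = inner ℝ a.1 b.1 + lorentz m a.2 b.2 := rfl

theorem flatMetric_comm (a b : FlatSpace k m) : flatMetric k m a b = flatMetric k m b a := by
  rw [flatMetric_apply, flatMetric_apply, real_inner_comm, lorentz_comm]

/-- On the Lorentz-orthogonal complement of `x` the Lorentzian product is positive definite. By the
Cauchy-Schwarz inequality in the first `m` coordinates it dominates a positive multiple of the sum
of their squares. -/
theorem lorentz_self_mul_le {x z : EuclideanSpace ℝ (Fin (m + 1))} (hx : lorentz m x x = -1)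
    (hz : lorentz m z x = 0) :
    ∑ i : Fin m, z i.castSucc ^ 2 ≤ x (Fin.last m) ^ 2 * lorentz m z z := by
  rw [lorentz_apply] at *
  have hcs := Finset.sum_mul_sq_le_sq_mul_sq Finset.univ (fun i : Fin m => z i.castSucc)
    (fun i => x i.castSucc)
  simp only [← pow_two] at *
  have h1 : ∑ i : Fin m, x i.castSucc ^ 2 = x (Fin.last m) ^ 2 - 1 := by linarith
  have h2 : ∑ i : Fin m, z i.castSucc * x i.castSucc = z (Fin.last m) * x (Fin.last m) := by
    linarith
  rw [h1, h2] at hcs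
  nlinarith

theorem lorentz_self_nonneg {x z : EuclideanSpace ℝ (Fin (m + 1))} (hx : lorentz m x x = -1)
    (hz : lorentz m z x = 0) : 0 ≤ lorentz m z z := by
  have h := lorentz_self_mul_le hx hz
  have h0 : 0 ≤ ∑ i : Fin m, z i.castSucc ^ 2 := Finset.sum_nonneg fun i _ => sq_nonneg _
  have h1 : 0 < x (Fin.last m) ^ 2 := by
    rw [lorentz_apply] at hx
    have : 0 ≤ ∑ i : Fin m, x i.castSucc * x i.castSucc :=
      Finset.sum_nonneg fun i _ => mul_self_nonneg _
    nlinarith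
  exact nonneg_of_mul_nonneg_right (h0.trans h) h1

theorem eq_zero_of_lorentz_self_eq_zero {x z : EuclideanSpace ℝ (Fin (m + 1))}
    (hx : lorentz m x x = -1) (hz : lorentz m z x = 0) (h0 : lorentz m z z = 0) : z = 0 := by
  have h := lorentz_self_mul_le hx hz
  rw [h0, mul_zero] at h
  have h1 : ∀ i : Fin m, z i.castSucc = 0 := by
    have h2 := le_antisymm h (Finset.sum_nonneg fun i _ => sq_nonneg _)
    rw [Finset.sum_eq_zero_iff_of_nonneg fun i _ => sq_nonneg _] at h2
    intro i
    simpa using h2 i (Finset.mem_univ i)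
  rw [lorentz_apply] at h0
  simp only [h1, mul_zero, Finset.sum_const_zero, zero_sub, neg_eq_zero, mul_self_eq_zero] at h0
  ext i
  refine Fin.lastCases ?_ (fun j => ?_) i
  · simpa using h0
  · simpa using h1 j

/-- The projection of `ℝ^{m+1}` to the first `m` coordinates. -/
def initProj (m : ℕ) : EuclideanSpace ℝ (Fin (m + 1)) →L[ℝ] EuclideanSpace ℝ (Fin m) :=
  LinearMap.toContinuousLinearMap
    { toFun := fun x => WithLp.toLp 2 (fun i => x i.castSucc)
      map_add' := by intro a b; ext; simp
      map_smul' := by intro a b; ext; simp }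

theorem contMDiff_coe_hyperboloid :
    ContMDiff (𝓡 m) 𝓘(ℝ, EuclideanSpace ℝ (Fin (m + 1))) ∞
      (fun x : Hyperboloid m => (x : EuclideanSpace ℝ (Fin (m + 1)))) := by
  intro x
  have h1 : ContMDiffAt (𝓡 m) 𝓘(ℝ, EuclideanSpace ℝ (Fin m)) ∞ (extChartAt (𝓡 m) x) x :=
    contMDiffAt_extChartAt
  have h2 : ContDiff ℝ ∞ (fun y : EuclideanSpace ℝ (Fin m) =>
      ((hyperboloidHomeo m).symm y : EuclideanSpace ℝ (Fin (m + 1)))) := by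
    change ContDiff ℝ ∞ (fun y : EuclideanSpace ℝ (Fin m) =>
      WithLp.toLp 2 (Fin.snoc (α := fun _ => ℝ) (fun i => y i) (√(1 + ∑ i, y i ^ 2))))
    rw [contDiff_euclidean]
    intro i
    refine Fin.lastCases ?_ (fun j => ?_) i
    · simp only [Fin.snoc_last]
      refine ContDiff.sqrt (by fun_prop) fun y => ?_
      positivity
    · simp only [Fin.snoc_castSucc]
      fun_prop
  have h3 := h2.contMDiff.contMDiffAt.comp x h1
  refine h3.congr_of_eventuallyEq (Filter.Eventually.of_forall fun y => ?_)
  exact congrArg Subtype.val ((hyperboloidHomeo m).symm_apply_apply y).symm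

theorem lorentz_mvfderiv_coe (x : Hyperboloid m) (v : TangentSpace (𝓡 m) x) :
    lorentz m (mvfderiv (𝓡 m) (fun y : Hyperboloid m => y.1) x v) x.1 = 0 := by
  have hd : MDifferentiableAt (𝓡 m) 𝓘(ℝ, EuclideanSpace ℝ (Fin (m + 1)))
    (fun y : Hyperboloid m => y.1) x := (contMDiff_coe_hyperboloid x).mdifferentiableAt (by simp)
  have h := mvfderiv_bilin (lorentz m) hd hd v
  have h1 : (fun y : Hyperboloid m => lorentz m y.1 y.1) = fun _ => -1 := funext fun y => y.2.1
  rw [h1, mvfderiv_const, lorentz_comm x.1] at h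
  simp only [zero_apply] at h
  linarith

theorem initProj_mvfderiv_coe (x : Hyperboloid m) (v : TangentSpace (𝓡 m) x) :
    initProj m (mvfderiv (𝓡 m) (fun y : Hyperboloid m => y.1) x v) =
      mvfderiv (𝓡 m) (extChartAt (𝓡 m) x) x v := by
  have hd : MDifferentiableAt (𝓡 m) 𝓘(ℝ, EuclideanSpace ℝ (Fin (m + 1)))
    (fun y : Hyperboloid m => y.1) x := (contMDiff_coe_hyperboloid x).mdifferentiableAt (by simp)
  exact (mvfderiv_clm_comp (initProj m) hd v).symm

theorem isInvertible_mvfderiv_extChartAt_hyperboloid (x : Hyperboloid m) :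
    (mvfderiv (𝓡 m) (extChartAt (𝓡 m) x) x :
      TangentSpace (𝓡 m) x →L[ℝ] EuclideanSpace ℝ (Fin m)).IsInvertible :=
  isInvertible_mfderiv_extChartAt (mem_extChartAt_source x)

theorem mvfderiv_coe_hyperboloid_injective (x : Hyperboloid m) :
    Function.Injective (mvfderiv (𝓡 m) (fun y : Hyperboloid m => y.1) x) := by
  intro v w h
  apply (isInvertible_mvfderiv_extChartAt_hyperboloid x).injective
  rw [← initProj_mvfderiv_coe, ← initProj_mvfderiv_coe, h]

theorem exists_mvfderiv_coe_hyperboloid_eq (x : Hyperboloid m)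
    {z : EuclideanSpace ℝ (Fin (m + 1))} (hz : lorentz m z x.1 = 0) :
    ∃ v, mvfderiv (𝓡 m) (fun y : Hyperboloid m => y.1) x v = z := by
  obtain ⟨v, hv⟩ := (isInvertible_mvfderiv_extChartAt_hyperboloid x).surjective (initProj m z)
  refine ⟨v, ?_⟩
  have h1 := initProj_mvfderiv_coe x v
  rw [hv] at h1
  have h2 := lorentz_mvfderiv_coe x v
  rw [lorentz_apply] at h2 hz
  have h3 : ∀ i : Fin m, mvfderiv (𝓡 m) (fun y : Hyperboloid m => y.1) x v i.castSucc =
      z i.castSucc := fun i => congrFun (congrArg WithLp.ofLp h1) i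
  simp only [h3] at h2
  -- orthogonality to `x` determines the last coordinate, since that of `x` is positive
  have h4 : mvfderiv (𝓡 m) (fun y : Hyperboloid m => y.1) x v (Fin.last m) = z (Fin.last m) :=
    mul_right_cancel₀ x.2.2.ne' (by linarith)
  ext i
  exact Fin.lastCases h4 h3 i

theorem contMDiff_coe_USphere :
    ContMDiff (𝓡 k) 𝓘(ℝ, EuclideanSpace ℝ (Fin (k + 1))) ∞
      (fun x : USphere k => (x : EuclideanSpace ℝ (Fin (k + 1)))) :=
  have := Fact.mk (@finrank_euclideanSpace_fin ℝ _ (k + 1))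
  contMDiff_coe_sphere

theorem mvfderiv_coe_USphere_injective (x : USphere k) :
    Function.Injective (mvfderiv (𝓡 k)
      (fun x : USphere k => (x : EuclideanSpace ℝ (Fin (k + 1)))) x) :=
  have := Fact.mk (@finrank_euclideanSpace_fin ℝ _ (k + 1))
  injective_mvfderiv_subtypeVal_sphere x

theorem range_mvfderiv_coe_USphere (x : USphere k) :
    (mvfderiv (𝓡 k) (fun x : USphere k => (x : EuclideanSpace ℝ (Fin (k + 1)))) x).range =
      (ℝ ∙ (x : EuclideanSpace ℝ (Fin (k + 1))))ᗮ :=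
  have := Fact.mk (@finrank_euclideanSpace_fin ℝ _ (k + 1))
  range_mvfderiv_subtypeVal x

theorem contMDiff_sxhIncl :
    ContMDiff (sxhI k m) 𝓘(ℝ, FlatSpace k m) ∞ (sxhIncl : SxH k m → FlatSpace k m) :=
  (contMDiff_coe_USphere.comp contMDiff_fst).prodMk_space
    (contMDiff_coe_hyperboloid.comp contMDiff_snd)

theorem mdifferentiableAt_sxhIncl (q : SxH k m) :
    MDifferentiableAt (sxhI k m) 𝓘(ℝ, FlatSpace k m) sxhIncl q :=
  (contMDiff_sxhIncl q).mdifferentiableAt (by simp)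

theorem sxhEmb_apply (q : SxH k m) (v : TangentSpace (𝓡 k) q.1) (w : TangentSpace (𝓡 m) q.2) :
    sxhEmb q ((v, w) : TangentSpace (𝓡 k) q.1 × TangentSpace (𝓡 m) q.2) =
      (mvfderiv (𝓡 k) (fun y : USphere k => (y : EuclideanSpace ℝ (Fin (k + 1)))) q.1 v,
        mvfderiv (𝓡 m) (fun y : Hyperboloid m => y.1) q.2 w) := by
  have hs : MDifferentiableAt (𝓡 k) 𝓘(ℝ, EuclideanSpace ℝ (Fin (k + 1)))
      (fun y : USphere k => (y : EuclideanSpace ℝ (Fin (k + 1)))) q.1 :=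
    (contMDiff_coe_USphere q.1).mdifferentiableAt (by simp)
  have hh : MDifferentiableAt (𝓡 m) 𝓘(ℝ, EuclideanSpace ℝ (Fin (m + 1)))
      (fun y : Hyperboloid m => y.1) q.2 :=
    (contMDiff_coe_hyperboloid q.2).mdifferentiableAt (by simp)
  have h1 := HasMFDerivAt.comp q hs.hasMFDerivAt_mvfderiv
    (hasMFDerivAt_fst (I := 𝓡 k) (I' := 𝓡 m) q)
  have h2 := HasMFDerivAt.comp q hh.hasMFDerivAt_mvfderiv
    (hasMFDerivAt_snd (I := 𝓡 k) (I' := 𝓡 m) q)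
  have h : HasMFDerivAt (sxhI k m) 𝓘(ℝ, FlatSpace k m) sxhIncl q _ :=
    ⟨(mdifferentiableAt_sxhIncl q).continuousAt, h1.2.prodMk h2.2⟩
  exact congrArg (fun l => l (v, w)) (HasMFDerivAt.mvfderiv_eq h)

theorem sxhEmb_prodStructure (q : SxH k m) (v : TangentSpace (sxhI k m) q) :
    sxhEmb q (prodStructure q v) = ((sxhEmb q v).1, -(sxhEmb q v).2) := by
  have h1 := sxhEmb_apply q v.1 v.2
  have h2 := sxhEmb_apply q v.1 (-v.2)
  refine Eq.trans h2 ?_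
  have h3 : sxhEmb q v = _ := h1
  rw [h3]
  exact Prod.ext rfl (map_neg (mvfderiv (𝓡 m) (fun y : Hyperboloid m => y.1) q.2) v.2)

theorem sxhMetric_apply (q : SxH k m) (v w : TangentSpace (sxhI k m) q) :
    sxhMetric q v w = flatMetric k m (sxhEmb q v) (sxhEmb q w) := rfl

theorem sxhMetric_comm (q : SxH k m) (v w : TangentSpace (sxhI k m) q) :
    sxhMetric q v w = sxhMetric q w v := flatMetric_comm _ _

theorem inner_sxhEmb_fst (q : SxH k m) (v : TangentSpace (sxhI k m) q) :
    inner ℝ (sxhEmb q v).1 (q.1 : EuclideanSpace ℝ (Fin (k + 1))) = 0 := by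
  have h1 : sxhEmb q v = _ := sxhEmb_apply q v.1 v.2
  rw [h1]
  have h2 : mvfderiv (𝓡 k) (fun y : USphere k => (y : EuclideanSpace ℝ (Fin (k + 1)))) q.1 v.1 ∈
      (ℝ ∙ (q.1 : EuclideanSpace ℝ (Fin (k + 1))))ᗮ := by
    rw [← range_mvfderiv_coe_USphere q.1]
    exact ⟨v.1, rfl⟩
  exact Submodule.mem_orthogonal_singleton_iff_inner_left.1 h2

theorem lorentz_sxhEmb_snd (q : SxH k m) (v : TangentSpace (sxhI k m) q) :
    lorentz m (sxhEmb q v).2 q.2.1 = 0 := by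
  have h1 : sxhEmb q v = _ := sxhEmb_apply q v.1 v.2
  rw [h1]
  exact lorentz_mvfderiv_coe q.2 v.2

/-- The tangent space of `S^k × H^m` is the orthogonal complement of `ξ₁` and `ξ₂`. -/
theorem exists_sxhEmb_eq (q : SxH k m) {z : FlatSpace k m}
    (h1 : inner ℝ z.1 (q.1 : EuclideanSpace ℝ (Fin (k + 1))) = 0)
    (h2 : lorentz m z.2 q.2.1 = 0) : ∃ v, sxhEmb q v = z := by
  have h3 : z.1 ∈ (ℝ ∙ (q.1 : EuclideanSpace ℝ (Fin (k + 1))))ᗮ :=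
    Submodule.mem_orthogonal_singleton_iff_inner_left.2 h1
  rw [← range_mvfderiv_coe_USphere q.1] at h3
  obtain ⟨a, ha⟩ := h3
  obtain ⟨b, hb⟩ := exists_mvfderiv_coe_hyperboloid_eq q.2 h2
  exact ⟨(a, b), (sxhEmb_apply q a b).trans (Prod.ext ha hb)⟩

theorem sxhEmb_injective (q : SxH k m) : Function.Injective (sxhEmb q) := by
  intro v w h
  have h1 : sxhEmb q v = _ := sxhEmb_apply q v.1 v.2
  have h2 : sxhEmb q w = _ := sxhEmb_apply q w.1 w.2
  rw [h1, h2, Prod.mk.injEq] at h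
  exact Prod.ext (mvfderiv_coe_USphere_injective q.1 h.1)
    (mvfderiv_coe_hyperboloid_injective q.2 h.2)

/-- The induced metric of `S^k × H^m` is definite, although `flatMetric` is not: `T H^m` is the
orthogonal complement of a timelike vector. -/
theorem eq_zero_of_sxhMetric_self_eq_zero (q : SxH k m) {v : TangentSpace (sxhI k m) q}
    (h : sxhMetric q v v = 0) : v = 0 := by
  rw [sxhMetric_apply, flatMetric_apply] at h
  have h1 := lorentz_self_nonneg q.2.2.1 (lorentz_sxhEmb_snd q v)
  have h2 : 0 ≤ inner ℝ (sxhEmb q v).1 (sxhEmb q v).1 := real_inner_self_nonneg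
  apply sxhEmb_injective q
  rw [map_zero]
  exact Prod.ext (inner_self_eq_zero.1 (by linarith : inner ℝ (sxhEmb q v).1 (sxhEmb q v).1 = 0))
    (eq_zero_of_lorentz_self_eq_zero q.2.2.1 (lorentz_sxhEmb_snd q v) (by linarith))

theorem sxhMetric_ext (q : SxH k m) {v w : TangentSpace (sxhI k m) q}
    (h : ∀ u, sxhMetric q v u = sxhMetric q w u) : v = w := by
  rw [← sub_eq_zero]
  apply eq_zero_of_sxhMetric_self_eq_zero q
  have h1 := h (v - w)
  rw [← sub_eq_zero] at h1
  refine Eq.trans ?_ h1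
  simp only [sxhMetric_apply, map_sub, sub_apply]
  ring

theorem flatMetric_xi1 (q : SxH k m) (z : FlatSpace k m) :
    flatMetric k m z (sxhXi1 q) = inner ℝ z.1 (q.1 : EuclideanSpace ℝ (Fin (k + 1))) := by
  simp [flatMetric_apply, sxhXi1]

theorem flatMetric_xi2 (q : SxH k m) (z : FlatSpace k m) :
    flatMetric k m z (sxhXi2 q) = lorentz m z.2 q.2.1 := by
  simp [flatMetric_apply, sxhXi2]

theorem flatMetric_xi1_sxhEmb (q : SxH k m) (v : TangentSpace (sxhI k m) q) :
    flatMetric k m (sxhXi1 q) (sxhEmb q v) = 0 := by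
  rw [flatMetric_comm, flatMetric_xi1, inner_sxhEmb_fst]

theorem flatMetric_xi2_sxhEmb (q : SxH k m) (v : TangentSpace (sxhI k m) q) :
    flatMetric k m (sxhXi2 q) (sxhEmb q v) = 0 := by
  rw [flatMetric_comm, flatMetric_xi2, lorentz_sxhEmb_snd]

theorem flatMetric_sxhEmb_xi1 (q : SxH k m) (v : TangentSpace (sxhI k m) q) :
    flatMetric k m (sxhEmb q v) (sxhXi1 q) = 0 := by
  rw [flatMetric_xi1, inner_sxhEmb_fst]

theorem flatMetric_sxhEmb_xi2 (q : SxH k m) (v : TangentSpace (sxhI k m) q) :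
    flatMetric k m (sxhEmb q v) (sxhXi2 q) = 0 := by
  rw [flatMetric_xi2, lorentz_sxhEmb_snd]

theorem flatMetric_xi1_xi1 (q : SxH k m) : flatMetric k m (sxhXi1 q) (sxhXi1 q) = 1 := by
  rw [flatMetric_xi1]
  simp [sxhXi1]

theorem flatMetric_xi2_xi2 (q : SxH k m) : flatMetric k m (sxhXi2 q) (sxhXi2 q) = -1 := by
  rw [flatMetric_xi2]
  exact q.2.2.1

theorem flatMetric_xi1_xi2 (q : SxH k m) : flatMetric k m (sxhXi1 q) (sxhXi2 q) = 0 := by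
  rw [flatMetric_xi2]
  simp [sxhXi1]

/-- `ξ₁`, `ξ₂` and the tangent space at `q` span the flat space, on which `flatMetric` is
non-degenerate. -/
theorem flatSpace_ext (q : SxH k m) {a b : FlatSpace k m}
    (h : ∀ u, flatMetric k m a (sxhEmb q u) = flatMetric k m b (sxhEmb q u))
    (h1 : flatMetric k m a (sxhXi1 q) = flatMetric k m b (sxhXi1 q))
    (h2 : flatMetric k m a (sxhXi2 q) = flatMetric k m b (sxhXi2 q)) : a = b := by
  obtain ⟨v, hv⟩ : ∃ v, sxhEmb q v = a - b := by
    apply exists_sxhEmb_eq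
    · rw [← flatMetric_xi1, map_sub, sub_apply, h1, sub_self]
    · rw [← flatMetric_xi2, map_sub, sub_apply, h2, sub_self]
  have h3 : sxhMetric q v v = 0 := by
    rw [sxhMetric_apply]
    nth_rw 1 [hv]
    rw [map_sub, sub_apply, h, sub_self]
  rw [eq_zero_of_sxhMetric_self_eq_zero q h3, map_zero] at hv
  exact (sub_eq_zero.1 hv.symm)

/-- The second fundamental form of `S^k × H^m` in the flat space,
`(v, w) ↦ ½ ḡ(v - ψ̄v, w) ξ₂ - ½ ḡ(v + ψ̄v, w) ξ₁`. -/
def ambientII (q : SxH k m) (v : TangentSpace (sxhI k m) q) :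
    TangentSpace (sxhI k m) q →L[ℝ] FlatSpace k m :=
  ((1 / 2 : ℝ) • sxhMetric q (v - prodStructure q v)).smulRight (sxhXi2 q)
    - ((1 / 2 : ℝ) • sxhMetric q (v + prodStructure q v)).smulRight (sxhXi1 q)

theorem ambientII_apply (q : SxH k m) (v w : TangentSpace (sxhI k m) q) :
    ambientII q v w = (1 / 2 * sxhMetric q (v - prodStructure q v) w) • sxhXi2 q
      - (1 / 2 * sxhMetric q (v + prodStructure q v) w) • sxhXi1 q := rfl

theorem flatMetric_ambientII_xi1 (q : SxH k m) (v w : TangentSpace (sxhI k m) q) :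
    flatMetric k m (ambientII q v w) (sxhXi1 q) =
      -(1 / 2 * sxhMetric q (v + prodStructure q v) w) := by
  have h21 := (flatMetric_comm _ _).trans (flatMetric_xi1_xi2 q)
  rw [ambientII_apply, map_sub, map_smul, map_smul, sub_apply, smul_apply, smul_apply, h21,
    flatMetric_xi1_xi1]
  simp

theorem flatMetric_ambientII_xi2 (q : SxH k m) (v w : TangentSpace (sxhI k m) q) :
    flatMetric k m (ambientII q v w) (sxhXi2 q) =
      -(1 / 2 * sxhMetric q (v - prodStructure q v) w) := by
  rw [ambientII_apply, map_sub, map_smul, map_smul, sub_apply, smul_apply, smul_apply,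
    flatMetric_xi1_xi2, flatMetric_xi2_xi2]
  simp

theorem flatMetric_ambientII_sxhEmb (q : SxH k m) (v w u : TangentSpace (sxhI k m) q) :
    flatMetric k m (ambientII q v w) (sxhEmb q u) = 0 := by
  rw [ambientII_apply, map_sub, map_smul, map_smul, sub_apply, smul_apply, smul_apply,
    flatMetric_xi1_sxhEmb, flatMetric_xi2_sxhEmb]
  simp

/-- The inner products of the second fundamental form, which enter the Gauss equation. The sign of
`⟨ξ₂, ξ₂⟩ = -1` cancels the terms without `ψ̄` and those with two factors `ψ̄`. -/
theorem flatMetric_ambientII (q : SxH k m) (v w v' w' : TangentSpace (sxhI k m) q) :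
    flatMetric k m (ambientII q v w) (ambientII q v' w') =
      1 / 2 * (sxhMetric q (prodStructure q v) w * sxhMetric q v' w'
        + sxhMetric q v w * sxhMetric q (prodStructure q v') w') := by
  have h21 := (flatMetric_comm _ _).trans (flatMetric_xi1_xi2 q)
  simp only [ambientII_apply, map_add, map_smul, add_apply, smul_apply, smul_eq_mul, map_sub,
    sub_apply, flatMetric_xi1_xi1, flatMetric_xi1_xi2, flatMetric_xi2_xi2, h21]
  ring

/-- The projection of the flat space onto `ℝ^{k+1} × 0`; it sends `q` to `ξ₁`. -/
def flatProj1 (k m : ℕ) : FlatSpace k m →L[ℝ] FlatSpace k m :=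
  (ContinuousLinearMap.inl ℝ _ _) ∘L (ContinuousLinearMap.fst ℝ _ _)

/-- The projection of the flat space onto `0 × ℝ^{m+1}`; it sends `q` to `ξ₂`. -/
def flatProj2 (k m : ℕ) : FlatSpace k m →L[ℝ] FlatSpace k m :=
  (ContinuousLinearMap.inr ℝ _ _) ∘L (ContinuousLinearMap.snd ℝ _ _)

theorem contMDiff_xi1 : ContMDiff (sxhI k m) 𝓘(ℝ, FlatSpace k m) ∞ (sxhXi1 : SxH k m → _) :=
  (flatProj1 k m).contMDiff.comp contMDiff_sxhIncl

theorem contMDiff_xi2 : ContMDiff (sxhI k m) 𝓘(ℝ, FlatSpace k m) ∞ (sxhXi2 : SxH k m → _) :=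
  (flatProj2 k m).contMDiff.comp contMDiff_sxhIncl

theorem mvfderiv_xi1 (q : SxH k m) (v : TangentSpace (sxhI k m) q) :
    mvfderiv (sxhI k m) sxhXi1 q v = (1 / 2 : ℝ) • sxhEmb q (v + prodStructure q v) := by
  have h := mvfderiv_clm_comp (flatProj1 k m) (mdifferentiableAt_sxhIncl q) v
  refine Eq.trans h ?_
  rw [map_add, sxhEmb_prodStructure]
  change ((sxhEmb q v).1, 0) = _
  ext1
  · simp only [Prod.smul_fst, Prod.fst_add]
    module
  · simp

theorem mvfderiv_xi2 (q : SxH k m) (v : TangentSpace (sxhI k m) q) :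
    mvfderiv (sxhI k m) sxhXi2 q v = (1 / 2 : ℝ) • sxhEmb q (v - prodStructure q v) := by
  have h := mvfderiv_clm_comp (flatProj2 k m) (mdifferentiableAt_sxhIncl q) v
  refine Eq.trans h ?_
  rw [map_sub, sxhEmb_prodStructure]
  change (0, (sxhEmb q v).2) = _
  ext1
  · simp
  · simp only [Prod.smul_snd, Prod.snd_sub]
    module

end Ambient

/-! ### Submanifolds of a flat space and the curvature of pulled back tangent bundles -/

section FlatAmbient

set_option linter.unusedSectionVars false

open Topology VectorField

variable {E : Type*} [NormedAddCommGroup E] [NormedSpace ℝ E] [FiniteDimensional ℝ E]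
  {H : Type*} [TopologicalSpace H] {I : ModelWithCorners ℝ E H}
  {M : Type*} [TopologicalSpace M] [ChartedSpace H M]
  {F : Type*} [NormedAddCommGroup F] [NormedSpace ℝ F] [FiniteDimensional ℝ F]
  {G : Type*} [TopologicalSpace G] {J : ModelWithCorners ℝ F G}
  {N : Type*} [TopologicalSpace N] [ChartedSpace G N]
  {V : Type*} [NormedAddCommGroup V] [NormedSpace ℝ V]
  [IsManifold J ∞ N] [IsManifold J 1 N] [IsManifold J 2 N]

theorem ContMDiff.mvfderiv_field [IsManifold I 1 M] {f : M → V} (hf : ContMDiff I 𝓘(ℝ, V) ∞ f)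
    {X : Π x : M, TangentSpace I x} (hX : SmoothField X) :
    ContMDiff I 𝓘(ℝ, V) ∞ (fun x => mvfderiv I f x (X x)) := fun x =>
  ContMDiffAt.mvfderiv_along (φ := id) hf (hX x)

/-- The curvature `∇_X ∇_Y s - ∇_Y ∇_X s - ∇_[X,Y] s` of the connection `∇` induced by `DN` on
`φ^* TN`. -/
def curvatureAlong (DN : CovariantDerivative J F (TangentSpace J : N → Type _)) (φ : M → N)
    (X Y : Π x : M, TangentSpace I x) (s : Π x : M, TangentSpace J (φ x)) :
    Π x : M, TangentSpace J (φ x) :=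
  fun x => covAlong DN φ (fun y => covAlong DN φ s y (Y y)) x (X x)
    - covAlong DN φ (fun y => covAlong DN φ s y (X y)) x (Y x)
    - covAlong DN φ s x (mlieBracket I X Y x)

/-- The map `ι : N → V` into a vector space with the symmetric form `B` induces a non-degenerate
metric `gN`, and the connection `DN` and the second fundamental form `α`, with values normal to
`N`, satisfy the Gauss formula `∂_v dι(Y) = dι(DN_v Y) + α(v, Y)`. -/
structure IsFlatGauss (B : V →L[ℝ] V →L[ℝ] ℝ) (ι : N → V)
    (gN : Π q : N, TangentSpace J q →L[ℝ] TangentSpace J q →L[ℝ] ℝ)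
    (DN : CovariantDerivative J F (TangentSpace J : N → Type _))
    (α : Π q : N, TangentSpace J q → TangentSpace J q →L[ℝ] V) : Prop where
  symm : ∀ a b, B a b = B b a
  smooth : ContMDiff J 𝓘(ℝ, V) ∞ ι
  metric : ∀ (q : N) (v w : TangentSpace J q),
    gN q v w = B (mvfderiv J ι q v) (mvfderiv J ι q w)
  nondeg : ∀ (q : N) (v : TangentSpace J q), (∀ u, gN q v u = 0) → v = 0
  gauss : ∀ (Y : Π q : N, TangentSpace J q) (q : N),
    MDifferentiableAt J J.tangent (fun q' => (⟨q', Y q'⟩ : TangentBundle J N)) q →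
    ∀ v : TangentSpace J q, mvfderiv J (fun q' => mvfderiv J ι q' (Y q')) q v =
      mvfderiv J ι q (DN Y q v) + α q v (Y q)
  normal : ∀ (q : N) (v w u : TangentSpace J q), B (α q v w) (mvfderiv J ι q u) = 0

namespace IsFlatGauss

variable {B : V →L[ℝ] V →L[ℝ] ℝ} {ι : N → V}
  {gN : Π q : N, TangentSpace J q →L[ℝ] TangentSpace J q →L[ℝ] ℝ}
  {DN : CovariantDerivative J F (TangentSpace J : N → Type _)}
  {α : Π q : N, TangentSpace J q → TangentSpace J q →L[ℝ] V}

theorem ext (h : IsFlatGauss B ι gN DN α)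
    {q : N} {v w : TangentSpace J q} (hvw : ∀ u, gN q v u = gN q w u) : v = w := by
  rw [← sub_eq_zero]
  refine h.nondeg q _ fun u => ?_
  rw [map_sub, sub_apply, hvw, sub_self]

section Along

variable {φ : M → N}

/-- Smoothness of a field along `φ` can be tested on its inner products with `dι(u)`. -/
theorem smoothAlong_of_inner (h : IsFlatGauss B ι gN DN α)
    {s : Π x : M, TangentSpace J (φ x)} {w : M → V}
    (hφ : ContMDiff I J ∞ φ) (hw : ContMDiff I 𝓘(ℝ, V) ∞ w)
    (hs : ∀ (x : M) (u : TangentSpace J (φ x)),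
      gN (φ x) (s x) u = B (w x) (mvfderiv J ι (φ x) u)) : SmoothAlong I φ s := by
  intro x
  refine contMDiffAt_along_of_inner B h.smooth (fun q v hv => h.nondeg q v fun u => ?_)
    hφ.contMDiffAt hw.contMDiffAt fun y u => ?_
  · rw [h.metric, hv]
  · rw [← h.metric, hs]

theorem mvfderiv_along (h : IsFlatGauss B ι gN DN α)
    {s : Π x : M, TangentSpace J (φ x)} (hs : SmoothAlong I φ s) (x : M)
    (v : TangentSpace I x) :
    mvfderiv I (fun y => mvfderiv J ι (φ y) (s y)) x v =
      mvfderiv J ι (φ x) (covAlong DN φ s x v) + α (φ x) (mfderiv I J φ x v) (s x) :=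
  mvfderiv_along_of_covariantDerivative h.smooth h.gauss hs.contMDiffAt v

theorem contMDiff_along (h : IsFlatGauss B ι gN DN α)
    {s : Π x : M, TangentSpace J (φ x)} (hs : SmoothAlong I φ s) :
    ContMDiff I 𝓘(ℝ, V) ∞ (fun y => mvfderiv J ι (φ y) (s y)) := fun _ =>
  hs.contMDiffAt.mvfderiv_along h.smooth

/-- The induced connection is the tangent part of the derivative in `V`. -/
theorem inner_covAlong (h : IsFlatGauss B ι gN DN α)
    {s : Π x : M, TangentSpace J (φ x)} (hs : SmoothAlong I φ s) (x : M)
    (v : TangentSpace I x) (u : TangentSpace J (φ x)) :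
    gN (φ x) (covAlong DN φ s x v) u =
      B (mvfderiv I (fun y => mvfderiv J ι (φ y) (s y)) x v) (mvfderiv J ι (φ x) u) := by
  rw [h.mvfderiv_along hs, map_add, add_apply, h.normal, add_zero, h.metric]

theorem smoothAlong_add (h : IsFlatGauss B ι gN DN α)
    {s t : Π x : M, TangentSpace J (φ x)} (hφ : ContMDiff I J ∞ φ)
    (hs : SmoothAlong I φ s) (ht : SmoothAlong I φ t) :
    SmoothAlong I φ (fun x => s x + t x) := by
  refine h.smoothAlong_of_inner hφ ((h.contMDiff_along hs).add (h.contMDiff_along ht))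
    fun x u => ?_
  rw [Pi.add_apply, ← map_add, h.metric]

theorem smoothAlong_sub (h : IsFlatGauss B ι gN DN α)
    {s t : Π x : M, TangentSpace J (φ x)} (hφ : ContMDiff I J ∞ φ)
    (hs : SmoothAlong I φ s) (ht : SmoothAlong I φ t) :
    SmoothAlong I φ (fun x => s x - t x) := by
  refine h.smoothAlong_of_inner hφ ((h.contMDiff_along hs).sub (h.contMDiff_along ht))
    fun x u => ?_
  rw [← map_sub, h.metric]

theorem covAlong_add (h : IsFlatGauss B ι gN DN α)
    {s t : Π x : M, TangentSpace J (φ x)} (hφ : ContMDiff I J ∞ φ)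
    (hs : SmoothAlong I φ s) (ht : SmoothAlong I φ t) (x : M) (v : TangentSpace I x) :
    covAlong DN φ (fun x => s x + t x) x v = covAlong DN φ s x v + covAlong DN φ t x v := by
  refine h.ext fun u => ?_
  rw [h.inner_covAlong (h.smoothAlong_add hφ hs ht), map_add, add_apply, h.inner_covAlong hs,
    h.inner_covAlong ht]
  simp only [map_add]
  rw [mvfderiv_fun_add ((h.contMDiff_along hs x).mdifferentiableAt (by simp))
    ((h.contMDiff_along ht x).mdifferentiableAt (by simp))]
  simp only [add_apply, map_add]

theorem covAlong_sub (h : IsFlatGauss B ι gN DN α)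
    {s t : Π x : M, TangentSpace J (φ x)} (hφ : ContMDiff I J ∞ φ)
    (hs : SmoothAlong I φ s) (ht : SmoothAlong I φ t) (x : M) (v : TangentSpace I x) :
    covAlong DN φ (fun x => s x - t x) x v = covAlong DN φ s x v - covAlong DN φ t x v := by
  refine h.ext fun u => ?_
  rw [h.inner_covAlong (h.smoothAlong_sub hφ hs ht), map_sub, sub_apply, h.inner_covAlong hs,
    h.inner_covAlong ht]
  simp only [map_sub]
  rw [mvfderiv_fun_sub ((h.contMDiff_along hs x).mdifferentiableAt (by simp))
    ((h.contMDiff_along ht x).mdifferentiableAt (by simp))]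
  simp only [sub_apply, map_sub]

variable [I.Boundaryless] [IsManifold I ∞ M] [IsManifold I 1 M]

theorem smoothAlong_covAlong (h : IsFlatGauss B ι gN DN α)
    {s : Π x : M, TangentSpace J (φ x)} {X : Π x : M, TangentSpace I x}
    (hφ : ContMDiff I J ∞ φ) (hs : SmoothAlong I φ s) (hX : SmoothField X) :
    SmoothAlong I φ (fun x => covAlong DN φ s x (X x)) :=
  h.smoothAlong_of_inner hφ ((h.contMDiff_along hs).mvfderiv_field hX)
    fun x u => h.inner_covAlong hs x (X x) u

end Along

section Curvature

variable {φ : M → N} [I.Boundaryless] [IsManifold I ∞ M] [IsManifold I 1 M]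

/-- The Gauss equation of `ι` pulled back along `φ`: as the target `V` is flat, only the second
fundamental form `α` of `ι` contributes to the curvature of `φ^* TN`. -/
theorem inner_curvatureAlong (h : IsFlatGauss B ι gN DN α) (hφ : ContMDiff I J ∞ φ)
    {s : Π x : M, TangentSpace J (φ x)} (hs : SmoothAlong I φ s)
    {X Y : Π x : M, TangentSpace I x} (hX : SmoothField X) (hY : SmoothField Y)
    (x : M) (u : TangentSpace J (φ x)) :
    gN (φ x) (curvatureAlong DN φ X Y s x) u =
      B (α (φ x) (mfderiv I J φ x (Y x)) (s x)) (α (φ x) (mfderiv I J φ x (X x)) u)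
        - B (α (φ x) (mfderiv I J φ x (X x)) (s x)) (α (φ x) (mfderiv I J φ x (Y x)) u) := by
  -- differentiate `⟨α(φ_* Y, s), dι(u)⟩ = 0` along `X`, for an extension of `u` to a vector field
  have key : ∀ X Y : Π x : M, TangentSpace I x, SmoothField X → SmoothField Y →
      gN (φ x) (covAlong DN φ (fun y => covAlong DN φ s y (Y y)) x (X x)) u =
        B (mvfderiv I (fun y => mvfderiv I (fun z => mvfderiv J ι (φ z) (s z)) y (Y y)) x (X x))
          (mvfderiv J ι (φ x) u)
        + B (α (φ x) (mfderiv I J φ x (Y x)) (s x))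
            (α (φ x) (mfderiv I J φ x (X x)) u) := by
    intro X Y hX hY
    have hQ := h.smoothAlong_covAlong hφ hs hY
    have hQd := (h.contMDiff_along hQ x).mdifferentiableAt (by simp)
    have hwd := (((h.contMDiff_along hs).mvfderiv_field hY) x).mdifferentiableAt (by simp)
    have ha : (fun y => α (φ y) (mfderiv I J φ y (Y y)) (s y)) = fun y =>
        mvfderiv I (fun z => mvfderiv J ι (φ z) (s z)) y (Y y)
          - mvfderiv J ι (φ y) (covAlong DN φ s y (Y y)) := by
      funext y
      rw [h.mvfderiv_along hs, add_sub_cancel_left]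
    have had : MDifferentiableAt I 𝓘(ℝ, V)
        (fun y => α (φ y) (mfderiv I J φ y (Y y)) (s y)) x := by
      rw [ha]
      exact hwd.sub hQd
    have hu : ContMDiffAt I J.tangent ∞
        (fun y => (⟨φ y, FiberBundle.extend F u (φ y)⟩ : TangentBundle J N)) x :=
      (FiberBundle.contMDiffAt_extend J F u (k := ∞)).comp x hφ.contMDiffAt
    have hu0 : FiberBundle.extend F u (φ x) = u := FiberBundle.extend_apply_self ..
    have h1 := mvfderiv_bilin B had ((hu.mvfderiv_along h.smooth).mdifferentiableAt (by simp)) (X x)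
    have h2 : (fun y => B (α (φ y) (mfderiv I J φ y (Y y)) (s y))
        (mvfderiv J ι (φ y) (FiberBundle.extend F u (φ y)))) = fun _ => 0 :=
      funext fun y => h.normal _ _ _ _
    rw [h2, mvfderiv_const, zero_apply,
      mvfderiv_along_of_covariantDerivative h.smooth h.gauss hu, map_add, h.normal, zero_add,
      hu0, ha, mvfderiv_fun_sub hwd hQd, sub_apply, map_sub, sub_apply, ← h.inner_covAlong hQ] at h1
    linarith
  have h3 := mvfderiv_mlieBracket (h.contMDiff_along hs)
    ((hX x).mdifferentiableAt (by simp)) ((hY x).mdifferentiableAt (by simp))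
  rw [curvatureAlong, map_sub, map_sub, sub_apply, sub_apply, key X Y hX hY, key Y X hY hX,
    h.inner_covAlong hs, h3, map_sub, sub_apply]
  ring

theorem covAlong_id (h : IsFlatGauss B ι gN DN α) {Y : Π q : N, TangentSpace J q}
    (hY : SmoothField Y) (q : N) (v : TangentSpace J q) :
    covAlong DN (id : N → N) Y q v = DN Y q v := by
  refine h.ext fun u => ?_
  have h1 := h.inner_covAlong (φ := (id : N → N)) (I := J) (s := Y) hY q v u
  refine h1.trans ?_
  have h2 := h.gauss Y q ((hY q).mdifferentiableAt (by simp)) v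
  simp only [id]
  rw [h2, map_add, add_apply, h.normal, add_zero, h.metric]

/-- The Gauss equation of `ι`: the case `φ = id` of the pulled back equation. -/
theorem inner_curvature [J.Boundaryless] (h : IsFlatGauss B ι gN DN α)
    {X Y Z : Π q : N, TangentSpace J q}
    (hX : SmoothField X) (hY : SmoothField Y) (hZ : SmoothField Z) (q : N)
    (u : TangentSpace J q) :
    gN q (curvature DN X Y Z q) u =
      B (α q (Y q) (Z q)) (α q (X q) u) - B (α q (X q) (Z q)) (α q (Y q) u) := by
  have h1 := h.inner_curvatureAlong (φ := (id : N → N)) contMDiff_id (s := Z) hZ hX hY q u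
  have hs : ∀ W : Π q : N, TangentSpace J q, SmoothField W →
      (fun y => covAlong DN (id : N → N) Z y (W y)) = covField DN W Z := fun W _ =>
    funext fun y => h.covAlong_id hZ y (W y)
  have hs' : ∀ W : Π q : N, TangentSpace J q, SmoothField W → SmoothField (covField DN W Z) := by
    intro W hW
    have h2 := h.smoothAlong_covAlong (φ := (id : N → N)) contMDiff_id (s := Z) hZ hW
    rw [hs W hW] at h2
    exact h2
  rw [curvatureAlong, hs X hX, hs Y hY, h.covAlong_id (hs' X hX), h.covAlong_id (hs' Y hY),
    h.covAlong_id hZ, mfderiv_id] at h1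
  exact h1

end Curvature

end IsFlatGauss

end FlatAmbient

/-! ### Isometric immersions -/

section IsometricImmersion

set_option linter.unusedSectionVars false

open VectorField

variable {E : Type*} [NormedAddCommGroup E] [NormedSpace ℝ E] [FiniteDimensional ℝ E]
  {H : Type*} [TopologicalSpace H] {I : ModelWithCorners ℝ E H}
  {M : Type*} [TopologicalSpace M] [ChartedSpace H M]
  {F : Type*} [NormedAddCommGroup F] [NormedSpace ℝ F] [FiniteDimensional ℝ F]
  {G : Type*} [TopologicalSpace G] {J : ModelWithCorners ℝ F G}
  {N : Type*} [TopologicalSpace N] [ChartedSpace G N]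
  {V : Type*} [NormedAddCommGroup V] [NormedSpace ℝ V]
  [IsManifold J ∞ N] [IsManifold J 1 N] [IsManifold J 2 N]
  [IsManifold I ∞ M] [IsManifold I 1 M]
  {g : Bundle.ContMDiffRiemannianMetric I ∞ E (TangentSpace I : M → Type _)}
  {gN : Π q : N, TangentSpace J q →L[ℝ] TangentSpace J q →L[ℝ] ℝ}
  {φ : M → N}

theorem inner_tangentPart (x : M) (w : TangentSpace J (φ x)) (u : TangentSpace I x) :
    g.inner x (tangentPart g gN φ x w) u = gN (φ x) w (mfderiv I J φ x u) :=
  (existsUnique_sharp g x (gN (φ x) w ∘L mfderiv I J φ x)).choose_spec.1 u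

theorem tangentPart_eq_of_inner {x : M} {w : TangentSpace J (φ x)} {v : TangentSpace I x}
    (h : ∀ u, g.inner x v u = gN (φ x) w (mfderiv I J φ x u)) : tangentPart g gN φ x w = v :=
  ((existsUnique_sharp g x (gN (φ x) w ∘L mfderiv I J φ x)).choose_spec.2 v h).symm

theorem mfderiv_tangentPart_add_normalPart (x : M) (w : TangentSpace J (φ x)) :
    mfderiv I J φ x (tangentPart g gN φ x w) + normalPart g gN φ x w = w :=
  add_sub_cancel _ _

theorem inner_normalPart (hφ : IsIsometricImmersion g.inner gN φ) (x : M)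
    (w : TangentSpace J (φ x)) (u : TangentSpace I x) :
    gN (φ x) (normalPart g gN φ x w) (mfderiv I J φ x u) = 0 := by
  rw [normalPart, map_sub, sub_apply, hφ.2, inner_tangentPart, sub_self]

theorem tangentPart_mfderiv_add (hφ : IsIsometricImmersion g.inner gN φ) {x : M}
    (v : TangentSpace I x) {η : TangentSpace J (φ x)}
    (hη : ∀ u, gN (φ x) η (mfderiv I J φ x u) = 0) :
    tangentPart g gN φ x (mfderiv I J φ x v + η) = v :=
  tangentPart_eq_of_inner fun u => by rw [map_add, add_apply, hφ.2, hη, add_zero]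

theorem normalPart_mfderiv_add (hφ : IsIsometricImmersion g.inner gN φ) {x : M}
    (v : TangentSpace I x) {η : TangentSpace J (φ x)}
    (hη : ∀ u, gN (φ x) η (mfderiv I J φ x u) = 0) :
    normalPart g gN φ x (mfderiv I J φ x v + η) = η := by
  rw [normalPart, tangentPart_mfderiv_add hφ v hη, add_sub_cancel_left]

/-- The decomposition of a vector into a tangent and a normal part is unique. -/
theorem mfderiv_add_inj (hφ : IsIsometricImmersion g.inner gN φ) {x : M} {v v' : TangentSpace I x}
    {η η' : TangentSpace J (φ x)} (hη : ∀ u, gN (φ x) η (mfderiv I J φ x u) = 0)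
    (hη' : ∀ u, gN (φ x) η' (mfderiv I J φ x u) = 0)
    (h : mfderiv I J φ x v + η = mfderiv I J φ x v' + η') : v = v' ∧ η = η' := by
  have hv : v = v' := by
    rw [← tangentPart_mfderiv_add hφ v hη, h, tangentPart_mfderiv_add hφ v' hη']
  subst hv
  exact ⟨rfl, add_left_cancel h⟩

theorem smoothAlong_pushField (hφ : ContMDiff I J ∞ φ) {X : Π x : M, TangentSpace I x}
    (hX : SmoothField X) : SmoothAlong I φ (pushField (J := J) φ X) :=
  (hφ.contMDiff_tangentMap (m := ∞) le_rfl).comp hX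

/-- The Weingarten formula. -/
theorem covAlong_eq_normalCov_sub_weingarten
    {DN : CovariantDerivative J F (TangentSpace J : N → Type _)} (X : Π x : M, TangentSpace I x)
    (ξ : Π x : M, TangentSpace J (φ x)) (x : M) :
    covAlong DN φ ξ x (X x) =
      normalCov g gN DN φ X ξ x - pushField φ (weingarten g gN DN φ ξ X) x := by
  rw [pushField, weingarten, map_neg, sub_neg_eq_add, add_comm]
  exact (mfderiv_tangentPart_add_normalPart x _).symm

theorem IsLeviCivita.mlieBracket_eq [IsManifold I 2 M]
    {D : CovariantDerivative I E (TangentSpace I : M → Type _)} (hD : IsLeviCivita g.inner D)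
    {X Y : Π x : M, TangentSpace I x} (hX : SmoothField X) (hY : SmoothField Y) (x : M) :
    mlieBracket I X Y x = covField D X Y x - covField D Y X x :=
  (D.torsion_eq_zero_iff.1 hD.1 ((hX x).mdifferentiableAt (by simp))
    ((hY x).mdifferentiableAt (by simp))).symm

namespace IsFlatGauss

variable [I.Boundaryless] [IsManifold I 2 M] {B : V →L[ℝ] V →L[ℝ] ℝ} {ι : N → V}
  {DN : CovariantDerivative J F (TangentSpace J : N → Type _)}
  {α : Π q : N, TangentSpace J q → TangentSpace J q →L[ℝ] V}
  {D : CovariantDerivative I E (TangentSpace I : M → Type _)}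

theorem mvfderiv_comp (h : IsFlatGauss B ι gN DN α) (hφ : ContMDiff I J ∞ φ) (x : M)
    (v : TangentSpace I x) :
    mvfderiv I (fun y => ι (φ y)) x v = mvfderiv J ι (φ x) (mfderiv I J φ x v) :=
  mvfderiv_comp_mfderiv ((h.smooth _).mdifferentiableAt (by simp))
    ((hφ x).mdifferentiableAt (by simp)) v

/-- The metric `g` is induced by the flat map `ι ∘ φ`. -/
theorem metric_comp (h : IsFlatGauss B ι gN DN α) (hφ : IsIsometricImmersion g.inner gN φ) (x : M)
    (v w : TangentSpace I x) :
    g.inner x v w =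
      B (mvfderiv I (fun y => ι (φ y)) x v) (mvfderiv I (fun y => ι (φ y)) x w) := by
  rw [← hφ.2, h.metric, h.mvfderiv_comp hφ.1, h.mvfderiv_comp hφ.1]

theorem smoothField_tangentPart (h : IsFlatGauss B ι gN DN α)
    (hφ : IsIsometricImmersion g.inner gN φ) {s : Π x : M, TangentSpace J (φ x)}
    (hs : SmoothAlong I φ s) : SmoothField (fun x => tangentPart g gN φ x (s x)) := by
  intro x
  refine contMDiffAt_along_of_inner B (h.smooth.comp hφ.1) (fun y v hv => ?_) contMDiffAt_id
    (h.contMDiff_along hs).contMDiffAt fun y u => ?_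
  · by_contra hne
    exact (g.pos y v hne).ne' ((h.metric_comp hφ y v v).trans (hv v))
  · refine (h.metric_comp hφ y _ _).symm.trans ?_
    rw [inner_tangentPart, h.metric, ← h.mvfderiv_comp hφ.1]
    rfl

theorem smoothAlong_normalPart (h : IsFlatGauss B ι gN DN α)
    (hφ : IsIsometricImmersion g.inner gN φ) {s : Π x : M, TangentSpace J (φ x)}
    (hs : SmoothAlong I φ s) : SmoothAlong I φ (fun x => normalPart g gN φ x (s x)) :=
  h.smoothAlong_sub hφ.1 hs (smoothAlong_pushField hφ.1 (h.smoothField_tangentPart hφ hs))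

theorem smoothAlong_secondFF (h : IsFlatGauss B ι gN DN α)
    (hφ : IsIsometricImmersion g.inner gN φ) {X Y : Π x : M, TangentSpace I x}
    (hX : SmoothField X) (hY : SmoothField Y) : SmoothAlong I φ (secondFF g gN DN φ X Y) :=
  h.smoothAlong_normalPart hφ
    (h.smoothAlong_covAlong hφ.1 (smoothAlong_pushField hφ.1 hY) hX)

theorem smoothAlong_normalCov (h : IsFlatGauss B ι gN DN α)
    (hφ : IsIsometricImmersion g.inner gN φ) {X : Π x : M, TangentSpace I x}
    (hX : SmoothField X) {ξ : Π x : M, TangentSpace J (φ x)} (hξ : SmoothAlong I φ ξ) :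
    SmoothAlong I φ (normalCov g gN DN φ X ξ) :=
  h.smoothAlong_normalPart hφ (h.smoothAlong_covAlong hφ.1 hξ hX)

theorem smoothField_weingarten (h : IsFlatGauss B ι gN DN α)
    (hφ : IsIsometricImmersion g.inner gN φ) {X : Π x : M, TangentSpace I x}
    (hX : SmoothField X) {ξ : Π x : M, TangentSpace J (φ x)} (hξ : SmoothAlong I φ ξ) :
    SmoothField (weingarten g gN DN φ ξ X) :=
  (h.smoothField_tangentPart hφ (h.smoothAlong_covAlong hφ.1 hξ hX)).neg_section

/-- The tangent part of `∇_v φ_* Y` is the Levi-Civita derivative of `Y`, since both are the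
tangent part of the derivative of `Y` in the flat space `V`. -/
theorem tangentPart_covAlong_pushField (h : IsFlatGauss B ι gN DN α)
    (hφ : IsIsometricImmersion g.inner gN φ) (hD : IsLeviCivita g.inner D)
    {Y : Π x : M, TangentSpace I x} (hY : SmoothField Y) (x : M) (v : TangentSpace I x) :
    tangentPart g gN φ x (covAlong DN φ (pushField φ Y) x v) = D Y x v := by
  refine tangentPart_eq_of_inner fun u => ?_
  rw [h.inner_covAlong (smoothAlong_pushField hφ.1 hY), ← h.mvfderiv_comp hφ.1,
    ← hD.inner_mvfderiv h.symm (h.smooth.comp hφ.1) (h.metric_comp hφ)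
      ((hY x).mdifferentiableAt (by simp)) v u]
  simp only [pushField, ← h.mvfderiv_comp hφ.1]
  rfl

theorem smoothField_covField (h : IsFlatGauss B ι gN DN α)
    (hφ : IsIsometricImmersion g.inner gN φ) (hD : IsLeviCivita g.inner D)
    {X Y : Π x : M, TangentSpace I x} (hX : SmoothField X) (hY : SmoothField Y) :
    SmoothField (covField D X Y) := by
  have h1 := h.smoothField_tangentPart hφ
    (h.smoothAlong_covAlong hφ.1 (smoothAlong_pushField hφ.1 hY) hX)
  simp only [h.tangentPart_covAlong_pushField hφ hD hY] at h1
  exact h1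

/-- The Gauss formula. -/
theorem covAlong_pushField (h : IsFlatGauss B ι gN DN α)
    (hφ : IsIsometricImmersion g.inner gN φ) (hD : IsLeviCivita g.inner D)
    (X : Π x : M, TangentSpace I x) {Y : Π x : M, TangentSpace I x} (hY : SmoothField Y) (x : M) :
    covAlong DN φ (pushField φ Y) x (X x) =
      pushField φ (covField D X Y) x + secondFF g gN DN φ X Y x := by
  have h1 := mfderiv_tangentPart_add_normalPart (g := g) (gN := gN) x
    (covAlong DN φ (pushField φ Y) x (X x))
  rw [h.tangentPart_covAlong_pushField hφ hD hY] at h1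
  exact h1.symm

/-- The connection induced on `φ^* TN` has no torsion. -/
theorem covAlong_pushField_sub (h : IsFlatGauss B ι gN DN α) (hφ : ContMDiff I J ∞ φ)
    {X Y : Π x : M, TangentSpace I x} (hX : SmoothField X) (hY : SmoothField Y) (x : M) :
    covAlong DN φ (pushField φ Y) x (X x) - covAlong DN φ (pushField φ X) x (Y x) =
      mfderiv I J φ x (mlieBracket I X Y x) := by
  refine h.ext fun u => ?_
  have h1 := mvfderiv_mlieBracket (h.smooth.comp hφ)
    ((hX x).mdifferentiableAt (by simp)) ((hY x).mdifferentiableAt (by simp))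
  rw [map_sub, sub_apply, h.inner_covAlong (smoothAlong_pushField hφ hY),
    h.inner_covAlong (smoothAlong_pushField hφ hX), h.metric, ← h.mvfderiv_comp hφ]
  simp only [pushField, ← h.mvfderiv_comp hφ]
  rw [← sub_apply, ← map_sub]
  exact congrArg (fun z => B z _) h1.symm

/-- The second fundamental form is symmetric, as neither `D` nor the induced connection has
torsion. -/
theorem secondFF_comm (h : IsFlatGauss B ι gN DN α)
    (hφ : IsIsometricImmersion g.inner gN φ) (hD : IsLeviCivita g.inner D)
    {X Y : Π x : M, TangentSpace I x} (hX : SmoothField X) (hY : SmoothField Y) (x : M) :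
    secondFF g gN DN φ X Y x = secondFF g gN DN φ Y X x := by
  have h1 := h.covAlong_pushField_sub hφ.1 hX hY x
  rw [h.covAlong_pushField hφ hD X hY, h.covAlong_pushField hφ hD Y hX,
    hD.mlieBracket_eq hX hY, map_sub] at h1
  simp only [pushField] at h1
  rw [← sub_eq_zero, ← sub_eq_zero.2 h1]
  abel

/-- The second fundamental form is additive in the first field, applied to
`[X, Y] = D_X Y - D_Y X`. -/
theorem secondFF_mlieBracket (h : IsFlatGauss B ι gN DN α)
    (hφ : IsIsometricImmersion g.inner gN φ) (hD : IsLeviCivita g.inner D)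
    {X Y Z : Π x : M, TangentSpace I x} (hX : SmoothField X) (hY : SmoothField Y)
    (hZ : SmoothField Z) (x : M) :
    secondFF g gN DN φ (mlieBracket I X Y) Z x =
      secondFF g gN DN φ (covField D X Y) Z x - secondFF g gN DN φ (covField D Y X) Z x := by
  have h1 : ∀ U : Π x : M, TangentSpace I x, secondFF g gN DN φ U Z x =
      (covAlong DN φ (pushField φ Z) x - mfderiv I J φ x ∘L D Z x :
        TangentSpace I x →L[ℝ] TangentSpace J (φ x)) (U x) := fun U => by
    rw [sub_apply, h.covAlong_pushField hφ hD U hZ]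
    exact (add_sub_cancel_left _ _).symm
  rw [h1, h1, h1, hD.mlieBracket_eq hX hY, map_sub]

/-- The decomposition of the curvature of `φ^* TN` on a tangent field into its tangent and its
normal part. -/
theorem curvatureAlong_pushField (h : IsFlatGauss B ι gN DN α)
    (hφ : IsIsometricImmersion g.inner gN φ) (hD : IsLeviCivita g.inner D)
    {X Y Z : Π x : M, TangentSpace I x} (hX : SmoothField X) (hY : SmoothField Y)
    (hZ : SmoothField Z) (x : M) :
    curvatureAlong DN φ X Y (pushField φ Z) x =
      mfderiv I J φ x (curvature D X Y Z x
          - weingarten g gN DN φ (secondFF g gN DN φ Y Z) X x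
          + weingarten g gN DN φ (secondFF g gN DN φ X Z) Y x)
        + (covSecondFF g gN DN φ D X Y Z x - covSecondFF g gN DN φ D Y X Z x) := by
  have key : ∀ X Y : Π x : M, TangentSpace I x, SmoothField X → SmoothField Y →
      covAlong DN φ (fun y => covAlong DN φ (pushField φ Z) y (Y y)) x (X x) =
        mfderiv I J φ x (covField D X (covField D Y Z) x
            - weingarten g gN DN φ (secondFF g gN DN φ Y Z) X x)
          + (secondFF g gN DN φ X (covField D Y Z) x
            + normalCov g gN DN φ X (secondFF g gN DN φ Y Z) x) := by
    intro X Y hX hY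
    have hYZ := h.smoothField_covField hφ hD hY hZ
    simp only [h.covAlong_pushField hφ hD Y hZ]
    rw [h.covAlong_add hφ.1 (smoothAlong_pushField hφ.1 hYZ) (h.smoothAlong_secondFF hφ hY hZ),
      h.covAlong_pushField hφ hD X hYZ, covAlong_eq_normalCov_sub_weingarten (g := g) (gN := gN),
      map_sub]
    simp only [pushField]
    abel
  rw [curvatureAlong, key X Y hX hY, key Y X hY hX,
    h.covAlong_pushField hφ hD (mlieBracket I X Y) hZ, h.secondFF_mlieBracket hφ hD hX hY hZ]
  simp only [curvature, covSecondFF, pushField, Pi.sub_apply, map_add, map_sub]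
  abel

/-- The normal part of the curvature of `φ^* TN` on a normal field. -/
theorem normalPart_curvatureAlong (h : IsFlatGauss B ι gN DN α)
    (hφ : IsIsometricImmersion g.inner gN φ) (hD : IsLeviCivita g.inner D)
    {X Y : Π x : M, TangentSpace I x} (hX : SmoothField X) (hY : SmoothField Y)
    {ξ : Π x : M, TangentSpace J (φ x)} (hξ : SmoothAlong I φ ξ) (x : M) :
    normalPart g gN φ x (curvatureAlong DN φ X Y ξ x) =
      normalCurvature g gN DN φ X Y ξ x
        - secondFF g gN DN φ (weingarten g gN DN φ ξ Y) X x
        + secondFF g gN DN φ (weingarten g gN DN φ ξ X) Y x := by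
  have key : ∀ X Y : Π x : M, TangentSpace I x, SmoothField X → SmoothField Y →
      covAlong DN φ (fun y => covAlong DN φ ξ y (Y y)) x (X x) =
        mfderiv I J φ x (-(weingarten g gN DN φ (normalCov g gN DN φ Y ξ) X x)
            - covField D X (weingarten g gN DN φ ξ Y) x)
          + (normalCov g gN DN φ X (normalCov g gN DN φ Y ξ) x
            - secondFF g gN DN φ (weingarten g gN DN φ ξ Y) X x) := by
    intro X Y hX hY
    have hA := h.smoothField_weingarten hφ hY hξ
    simp only [covAlong_eq_normalCov_sub_weingarten (g := g) (gN := gN) Y ξ]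
    rw [h.covAlong_sub hφ.1 (h.smoothAlong_normalCov hφ hY hξ) (smoothAlong_pushField hφ.1 hA),
      h.covAlong_pushField hφ hD X hA, covAlong_eq_normalCov_sub_weingarten (g := g) (gN := gN),
      map_sub, map_neg, h.secondFF_comm hφ hD hX hA]
    simp only [pushField]
    abel
  have hn : ∀ u, gN (φ x) (normalCurvature g gN DN φ X Y ξ x
        - secondFF g gN DN φ (weingarten g gN DN φ ξ Y) X x
        + secondFF g gN DN φ (weingarten g gN DN φ ξ X) Y x) (mfderiv I J φ x u) = 0 := by
    intro u
    simp only [normalCurvature, Pi.sub_apply, normalCov, secondFF, map_add, map_sub, add_apply,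
      sub_apply, inner_normalPart hφ]
    simp
  rw [← normalPart_mfderiv_add hφ (-(weingarten g gN DN φ (normalCov g gN DN φ Y ξ) X x)
    - covField D X (weingarten g gN DN φ ξ Y) x
    + weingarten g gN DN φ (normalCov g gN DN φ X ξ) Y x
    + covField D Y (weingarten g gN DN φ ξ X) x
    + weingarten g gN DN φ ξ (mlieBracket I X Y) x) hn]
  congr 1
  rw [curvatureAlong, key X Y hX hY, key Y X hY hX,
    covAlong_eq_normalCov_sub_weingarten (g := g) (gN := gN) (mlieBracket I X Y)]
  simp only [normalCurvature, pushField, Pi.sub_apply, map_add, map_sub, map_neg]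
  abel

theorem inner_covSecondFF_sub (hφ : IsIsometricImmersion g.inner gN φ)
    (X Y Z : Π x : M, TangentSpace I x) (x : M) (u : TangentSpace I x) :
    gN (φ x) (covSecondFF g gN DN φ D X Y Z x - covSecondFF g gN DN φ D Y X Z x)
      (mfderiv I J φ x u) = 0 := by
  simp only [covSecondFF, Pi.sub_apply, normalCov, secondFF, map_sub, sub_apply,
    inner_normalPart hφ]
  simp

end IsFlatGauss

end IsometricImmersion

/-! ### The equations for `S^k × H^m` -/

section Equations

set_option linter.unusedSectionVars false

variable {k m : ℕ} {Dbar : CovariantDerivative (sxhI k m) (SxHModel k m)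
  (TangentSpace (sxhI k m) : SxH k m → Type _)}

theorem flatMetric_add_left (a b c : FlatSpace k m) :
    flatMetric k m (a + b) c = flatMetric k m a c + flatMetric k m b c := by
  rw [map_add, add_apply]

theorem flatMetric_sxhEmb_add_ambientII_xi1 (q : SxH k m) (u v w : TangentSpace (sxhI k m) q) :
    flatMetric k m (sxhEmb q u + ambientII q v w) (sxhXi1 q) =
      -(1 / 2 * sxhMetric q (v + prodStructure q v) w) :=
  (flatMetric_add_left _ _ _).trans ((congrArg₂ _ (flatMetric_sxhEmb_xi1 q u)
    (flatMetric_ambientII_xi1 q v w)).trans (zero_add _))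

/-- The `ξ₁`-component of the flat derivative of a tangent field `Y`, obtained by differentiating
`⟨Y, ξ₁⟩ = 0`. -/
theorem flatMetric_mvfderiv_sxhEmb_xi1 {Y : Π q : SxH k m, TangentSpace (sxhI k m) q} {q : SxH k m}
    (hY : MDifferentiableAt (sxhI k m) 𝓘(ℝ, FlatSpace k m) (fun q' => sxhEmb q' (Y q')) q)
    (v : TangentSpace (sxhI k m) q) :
    flatMetric k m (mvfderiv (sxhI k m) (fun q' => sxhEmb q' (Y q')) q v) (sxhXi1 q) =
      -(1 / 2 * sxhMetric q (v + prodStructure q v) (Y q)) := by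
  have h := mvfderiv_bilin (flatMetric k m) hY ((contMDiff_xi1 q).mdifferentiableAt (by simp)) v
  have h0 : (fun q' => flatMetric k m (sxhEmb q' (Y q')) (sxhXi1 q')) = fun _ => 0 :=
    funext fun q' => flatMetric_sxhEmb_xi1 q' _
  rw [h0, mvfderiv_const, zero_apply, mvfderiv_xi1, map_smul, smul_eq_mul, ← sxhMetric_apply,
    sxhMetric_comm] at h
  exact eq_neg_of_add_eq_zero_left h.symm

theorem flatMetric_sxhEmb_add_ambientII_xi2 (q : SxH k m) (u v w : TangentSpace (sxhI k m) q) :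
    flatMetric k m (sxhEmb q u + ambientII q v w) (sxhXi2 q) =
      -(1 / 2 * sxhMetric q (v - prodStructure q v) w) :=
  (flatMetric_add_left _ _ _).trans ((congrArg₂ _ (flatMetric_sxhEmb_xi2 q u)
    (flatMetric_ambientII_xi2 q v w)).trans (zero_add _))

/-- The `ξ₂`-component of the flat derivative of a tangent field `Y`, obtained by differentiating
`⟨Y, ξ₂⟩ = 0`. -/
theorem flatMetric_mvfderiv_sxhEmb_xi2 {Y : Π q : SxH k m, TangentSpace (sxhI k m) q} {q : SxH k m}
    (hY : MDifferentiableAt (sxhI k m) 𝓘(ℝ, FlatSpace k m) (fun q' => sxhEmb q' (Y q')) q)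
    (v : TangentSpace (sxhI k m) q) :
    flatMetric k m (mvfderiv (sxhI k m) (fun q' => sxhEmb q' (Y q')) q v) (sxhXi2 q) =
      -(1 / 2 * sxhMetric q (v - prodStructure q v) (Y q)) := by
  have h := mvfderiv_bilin (flatMetric k m) hY ((contMDiff_xi2 q).mdifferentiableAt (by simp)) v
  have h0 : (fun q' => flatMetric k m (sxhEmb q' (Y q')) (sxhXi2 q')) = fun _ => 0 :=
    funext fun q' => flatMetric_sxhEmb_xi2 q' _
  rw [h0, mvfderiv_const, zero_apply, mvfderiv_xi2, map_smul, smul_eq_mul, ← sxhMetric_apply,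
    sxhMetric_comm] at h
  exact eq_neg_of_add_eq_zero_left h.symm

/-- The Gauss formula of `S^k × H^m` in the flat space. -/
theorem mvfderiv_sxhEmb (hDbar : IsLeviCivita sxhMetric Dbar)
    {Y : Π q : SxH k m, TangentSpace (sxhI k m) q} {q : SxH k m}
    (hY : MDifferentiableAt (sxhI k m) (sxhI k m).tangent
      (fun q' => (⟨q', Y q'⟩ : TangentBundle (sxhI k m) (SxH k m))) q)
    (v : TangentSpace (sxhI k m) q) :
    mvfderiv (sxhI k m) (fun q' => sxhEmb q' (Y q')) q v =
      sxhEmb q (Dbar Y q v) + ambientII q v (Y q) := by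
  have hd : MDifferentiableAt (sxhI k m) 𝓘(ℝ, FlatSpace k m)
    (fun q' => sxhEmb q' (Y q')) q := hY.mvfderiv_along (φ := id) contMDiff_sxhIncl
  refine flatSpace_ext q (fun u => ?_)
    ((flatMetric_mvfderiv_sxhEmb_xi1 hd v).trans (flatMetric_sxhEmb_add_ambientII_xi1 ..).symm)
    ((flatMetric_mvfderiv_sxhEmb_xi2 hd v).trans (flatMetric_sxhEmb_add_ambientII_xi2 ..).symm)
  rw [map_add, add_apply, flatMetric_ambientII_sxhEmb, add_zero]
  exact hDbar.inner_mvfderiv flatMetric_comm contMDiff_sxhIncl sxhMetric_apply hY v u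

theorem isFlatGauss_sxh (hDbar : IsLeviCivita sxhMetric Dbar) :
    IsFlatGauss (flatMetric k m) sxhIncl sxhMetric Dbar ambientII where
  symm := flatMetric_comm
  smooth := contMDiff_sxhIncl
  metric := sxhMetric_apply
  nondeg q v h := eq_zero_of_sxhMetric_self_eq_zero q (h v)
  gauss _ _ hY v := mvfderiv_sxhEmb hDbar hY v
  normal := flatMetric_ambientII_sxhEmb

theorem half_smul_tangent_add_normal {V : Type*} [AddCommGroup V] [Module ℝ V] (a b c d : ℝ)
    (v w fv nv fw nw : V) :
    (1 / 2 : ℝ) • (a • v + b • (fv + nv) - c • w - d • (fw + nw)) =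
      (1 / 2 : ℝ) • (a • v + b • fv - c • w - d • fw) + (1 / 2 : ℝ) • (b • nv - d • nw) := by
  module

/-- A tangent vector whose inner products are those of the Gauss equation of `S^k × H^m` in the flat
space is the one given by the product structure. -/
theorem eq_of_inner_eq_ambientII (q : SxH k m) {r v w z : TangentSpace (sxhI k m) q}
    (h : ∀ u, sxhMetric q r u =
      flatMetric k m (ambientII q w z) (ambientII q v u)
        - flatMetric k m (ambientII q v z) (ambientII q w u)) :
    r = (1 / 2 : ℝ) • (sxhMetric q (prodStructure q w) z • v
      + sxhMetric q w z • prodStructure q v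
      - sxhMetric q (prodStructure q v) z • w
      - sxhMetric q v z • prodStructure q w) := by
  refine sxhMetric_ext q fun u => ?_
  rw [h, flatMetric_ambientII, flatMetric_ambientII]
  simp only [map_add, map_sub, map_smul, add_apply, sub_apply, smul_apply, smul_eq_mul]
  ring

variable {E : Type*} [NormedAddCommGroup E] [NormedSpace ℝ E] [FiniteDimensional ℝ E]
  {H : Type*} [TopologicalSpace H] {I : ModelWithCorners ℝ E H} [I.Boundaryless]
  {M : Type*} [TopologicalSpace M] [ChartedSpace H M] [IsManifold I ∞ M] [IsManifold I 1 M]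
  [IsManifold I 2 M]
  {g : Bundle.ContMDiffRiemannianMetric I ∞ E (TangentSpace I : M → Type _)}
  {D : CovariantDerivative I E (TangentSpace I : M → Type _)} {φ : M → SxH k m}

/-- The curvature of `φ^* T(S^k × H^m)`. -/
theorem curvatureAlong_sxh (hDbar : IsLeviCivita sxhMetric Dbar) (hφ : ContMDiff I (sxhI k m) ∞ φ)
    {X Y : Π x : M, TangentSpace I x} {s : Π x : M, TangentSpace (sxhI k m) (φ x)}
    (hX : SmoothField X) (hY : SmoothField Y) (hs : SmoothAlong I φ s) (x : M) :
    curvatureAlong Dbar φ X Y s x =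
      (1 / 2 : ℝ) • (sxhMetric (φ x) (prodStructure (φ x) (pushField φ Y x)) (s x) • pushField φ X x
        + sxhMetric (φ x) (pushField φ Y x) (s x) • prodStructure (φ x) (pushField φ X x)
        - sxhMetric (φ x) (prodStructure (φ x) (pushField φ X x)) (s x) • pushField φ Y x
        - sxhMetric (φ x) (pushField φ X x) (s x) • prodStructure (φ x) (pushField φ Y x)) :=
  eq_of_inner_eq_ambientII (φ x) fun u =>
    (isFlatGauss_sxh hDbar).inner_curvatureAlong hφ hs hX hY x u

theorem prodStructure_pushField (X : Π x : M, TangentSpace I x) (x : M) :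
    prodStructure (φ x) (pushField φ X x) =
      mfderiv I (sxhI k m) φ x (tangentProd g φ X x) + normalProd g φ X x :=
  (mfderiv_tangentPart_add_normalPart x _).symm

/-- The curvature of `φ^* T(S^k × H^m)` on a tangent field, split into its tangent and its normal
part. -/
theorem curvatureAlong_sxh_pushField (hDbar : IsLeviCivita sxhMetric Dbar)
    (hφ : IsIsometricImmersion g.inner sxhMetric φ) {X Y Z : Π x : M, TangentSpace I x}
    (hX : SmoothField X) (hY : SmoothField Y) (hZ : SmoothField Z) (x : M) :
    curvatureAlong Dbar φ X Y (pushField φ Z) x =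
      mfderiv I (sxhI k m) φ x ((1 / 2 : ℝ) • (g.inner x (tangentProd g φ Y x) (Z x) • X x
        + g.inner x (Y x) (Z x) • tangentProd g φ X x
        - g.inner x (tangentProd g φ X x) (Z x) • Y x
        - g.inner x (X x) (Z x) • tangentProd g φ Y x))
      + (1 / 2 : ℝ) • (g.inner x (Y x) (Z x) • normalProd g φ X x
        - g.inner x (X x) (Z x) • normalProd g φ Y x) := by
  have hm : ∀ W : Π x : M, TangentSpace I x,
      sxhMetric (φ x) (pushField φ W x) (pushField φ Z x) = g.inner x (W x) (Z x) :=
    fun W => hφ.2 x _ _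
  have hf : ∀ W : Π x : M, TangentSpace I x,
      sxhMetric (φ x) (prodStructure (φ x) (pushField φ W x)) (pushField φ Z x) =
        g.inner x (tangentProd g φ W x) (Z x) := fun W => (inner_tangentPart x _ _).symm
  rw [curvatureAlong_sxh hDbar hφ.1 hX hY (smoothAlong_pushField hφ.1 hZ), hm, hm, hf, hf]
  simp only [prodStructure_pushField (g := g), map_smul, map_add, map_sub]
  exact half_smul_tangent_add_normal ..

/-- The Gauss and Codazzi equations are the tangent and the normal part of one equation for the
curvature of `φ^* T(S^k × H^m)` on a tangent field. -/
theorem gauss_codazzi_sxh (hDbar : IsLeviCivita sxhMetric Dbar) (hD : IsLeviCivita g.inner D)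
    (hφ : IsIsometricImmersion g.inner sxhMetric φ) {X Y Z : Π x : M, TangentSpace I x}
    (hX : SmoothField X) (hY : SmoothField Y) (hZ : SmoothField Z) (x : M) :
    curvature D X Y Z x
        - weingarten g sxhMetric Dbar φ (secondFF g sxhMetric Dbar φ Y Z) X x
        + weingarten g sxhMetric Dbar φ (secondFF g sxhMetric Dbar φ X Z) Y x =
      (1 / 2 : ℝ) • (g.inner x (tangentProd g φ Y x) (Z x) • X x
        + g.inner x (Y x) (Z x) • tangentProd g φ X x
        - g.inner x (tangentProd g φ X x) (Z x) • Y x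
        - g.inner x (X x) (Z x) • tangentProd g φ Y x) ∧
    covSecondFF g sxhMetric Dbar φ D X Y Z x - covSecondFF g sxhMetric Dbar φ D Y X Z x =
      (1 / 2 : ℝ) • (g.inner x (Y x) (Z x) • normalProd g φ X x
        - g.inner x (X x) (Z x) • normalProd g φ Y x) := by
  refine mfderiv_add_inj hφ (IsFlatGauss.inner_covSecondFF_sub hφ X Y Z x) (fun u => ?_)
    (((isFlatGauss_sxh hDbar).curvatureAlong_pushField hφ hD hX hY hZ x).symm.trans
      (curvatureAlong_sxh_pushField hDbar hφ hX hY hZ x))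
  have hn : ∀ W : Π x : M, TangentSpace I x,
      sxhMetric (φ x) (normalProd g φ W x) (mfderiv I (sxhI k m) φ x u) = 0 :=
    fun W => inner_normalPart hφ x _ u
  simp only [map_smul, map_sub, smul_apply, sub_apply, hn, smul_zero, sub_zero]

/-- On a normal field the curvature of `φ^* T(S^k × H^m)` is tangent to `φ`, as
`ḡ(φ_* X, ξ) = 0`; its vanishing normal part is the Ricci equation. -/
theorem ricci_sxh (hDbar : IsLeviCivita sxhMetric Dbar) (hD : IsLeviCivita g.inner D)
    (hφ : IsIsometricImmersion g.inner sxhMetric φ)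
    {X Y : Π x : M, TangentSpace I x} {ξ : Π x : M, TangentSpace (sxhI k m) (φ x)}
    (hX : SmoothField X) (hY : SmoothField Y) (hξ : SmoothAlong I φ ξ)
    (hξn : IsNormalField I sxhMetric φ ξ) (x : M) :
    normalCurvature g sxhMetric Dbar φ X Y ξ x =
      secondFF g sxhMetric Dbar φ (weingarten g sxhMetric Dbar φ ξ Y) X x
        - secondFF g sxhMetric Dbar φ (weingarten g sxhMetric Dbar φ ξ X) Y x := by
  have h1 := (isFlatGauss_sxh hDbar).normalPart_curvatureAlong hφ hD hX hY hξ x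
  have hm : ∀ W : Π x : M, TangentSpace I x, sxhMetric (φ x) (pushField φ W x) (ξ x) = 0 :=
    fun W => (sxhMetric_comm _ _ _).trans (hξn x (W x))
  have h2 : curvatureAlong Dbar φ X Y ξ x = mfderiv I (sxhI k m) φ x
      ((1 / 2 : ℝ) • (sxhMetric (φ x) (prodStructure (φ x) (pushField φ Y x)) (ξ x) • X x
        - sxhMetric (φ x) (prodStructure (φ x) (pushField φ X x)) (ξ x) • Y x)) + 0 := by
    rw [curvatureAlong_sxh hDbar hφ.1 hX hY hξ, hm, hm]
    simp only [map_smul, map_sub, pushField]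
    module
  rw [h2, normalPart_mfderiv_add hφ _ (fun u => by simp)] at h1
  rw [← sub_eq_zero, h1]
  abel

end Equations

end

theorem mainTheorem2 (k m : ℕ)
    (Dbar : CovariantDerivative (sxhI k m) (SxHModel k m)
      (TangentSpace (sxhI k m) : SxH k m → Type _))
    (hDbar : IsLeviCivita sxhMetric Dbar) :
    -- the connection of the ambient space
    (∀ Y : Π q : SxH k m, TangentSpace (sxhI k m) q, SmoothField Y →
      ∀ (q : SxH k m) (v : TangentSpace (sxhI k m) q),
        mvfderiv (sxhI k m) (fun q' => sxhEmb q' (Y q')) q v =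
          sxhEmb q (Dbar Y q v)
            - (1 / 2 * sxhMetric q (v + prodStructure q v) (Y q)) • sxhXi1 q
            + (1 / 2 * sxhMetric q (v - prodStructure q v) (Y q)) • sxhXi2 q) ∧
    -- the curvature of the ambient space
    (∀ X Y Z : Π q : SxH k m, TangentSpace (sxhI k m) q,
      SmoothField X → SmoothField Y → SmoothField Z → ∀ q : SxH k m,
        curvature Dbar X Y Z q =
          (1 / 2 : ℝ) • (sxhMetric q (prodStructure q (Y q)) (Z q) • X q
            + sxhMetric q (Y q) (Z q) • prodStructure q (X q)
            - sxhMetric q (prodStructure q (X q)) (Z q) • Y q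
            - sxhMetric q (X q) (Z q) • prodStructure q (Y q))) ∧
    -- the equations of an isometric immersion of codimension `p`
    (∀ (n p : ℕ), n + p = k + m →
      ∀ (M : Type*) [TopologicalSpace M] [T2Space M] [SecondCountableTopology M]
        [ChartedSpace (EuclideanSpace ℝ (Fin n)) M] [IsManifold (𝓡 n) ∞ M]
        (g : Bundle.ContMDiffRiemannianMetric (𝓡 n) ∞ (EuclideanSpace ℝ (Fin n))
          (TangentSpace (𝓡 n) : M → Type _))
        (D : CovariantDerivative (𝓡 n) (EuclideanSpace ℝ (Fin n))
          (TangentSpace (𝓡 n) : M → Type _))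
        (φ : M → SxH k m),
        IsLeviCivita g.inner D → IsIsometricImmersion g.inner sxhMetric φ →
        -- Gauss
        (∀ X Y Z : Π x : M, TangentSpace (𝓡 n) x,
          SmoothField X → SmoothField Y → SmoothField Z → ∀ x : M,
            curvature D X Y Z x =
              weingarten g sxhMetric Dbar φ (secondFF g sxhMetric Dbar φ Y Z) X x
              - weingarten g sxhMetric Dbar φ (secondFF g sxhMetric Dbar φ X Z) Y x
              + (1 / 2 : ℝ) • (g.inner x (tangentProd g φ Y x) (Z x) • X x
                + g.inner x (Y x) (Z x) • tangentProd g φ X x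
                - g.inner x (tangentProd g φ X x) (Z x) • Y x
                - g.inner x (X x) (Z x) • tangentProd g φ Y x)) ∧
        -- Codazzi
        (∀ X Y Z : Π x : M, TangentSpace (𝓡 n) x,
          SmoothField X → SmoothField Y → SmoothField Z → ∀ x : M,
            covSecondFF g sxhMetric Dbar φ D X Y Z x - covSecondFF g sxhMetric Dbar φ D Y X Z x =
              (1 / 2 : ℝ) • (g.inner x (Y x) (Z x) • normalProd g φ X x
                - g.inner x (X x) (Z x) • normalProd g φ Y x)) ∧
        -- Ricci
        (∀ (X Y : Π x : M, TangentSpace (𝓡 n) x) (ξ : Π x : M, TangentSpace (sxhI k m) (φ x)),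
          SmoothField X → SmoothField Y →
          SmoothAlong (𝓡 n) φ ξ → IsNormalField (𝓡 n) sxhMetric φ ξ → ∀ x : M,
            normalCurvature g sxhMetric Dbar φ X Y ξ x =
              secondFF g sxhMetric Dbar φ (weingarten g sxhMetric Dbar φ ξ Y) X x
              - secondFF g sxhMetric Dbar φ (weingarten g sxhMetric Dbar φ ξ X) Y x)) := by
  refine ⟨fun Y hY q v => ?_, fun X Y Z hX hY hZ q => ?_, fun n p _ M _ _ _ _ _ g D φ hD hφ =>
    ⟨fun X Y Z hX hY hZ x => ?_, fun X Y Z hX hY hZ x => ?_, fun X Y ξ hX hY hξ hξn x => ?_⟩⟩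
  · rw [mvfderiv_sxhEmb hDbar ((hY q).mdifferentiableAt (by simp)), ambientII_apply]
    abel
  · exact eq_of_inner_eq_ambientII q fun u =>
      (isFlatGauss_sxh hDbar).inner_curvature hX hY hZ q u
  · rw [← (gauss_codazzi_sxh hDbar hD hφ hX hY hZ x).1]
    abel
  · exact (gauss_codazzi_sxh hDbar hD hφ hX hY hZ x).2
  · exact ricci_sxh hDbar hD hφ hX hY hξ hξn x
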